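/- Let $n\ge 3$, $1<p<\infty$, $p'=p/(p-1)$, and let $q=ab$ with complex-valued $a\in L_r(\mathbb R^n)$, $b\in L_s(\mathbb R^n)$, where $0<r\le\infty$, $p\le s\le\infty$ and $\frac1r+\frac1s<\frac2n$ (with $\frac1\infty=0$). Assume that $$\sup_x\int_{|x-y|<1}|a(y)|^{p'}|x-y|^{\nu-n}\,dy<\infty,\qquad \sup_x\int_{|x-y|<1}|b(y)|^{p}|x-y|^{\mu-n}\,dy<\infty$$ for some $0<\nu<p'$ and some $0<\mu<p$, and that $\int_{|x-y|<1}|q(y)|\,dy\to0$ as $|x|\to\infty$. Let $H_0=-\Delta$ in $L_p(\mathbb R^n)$ with domain the Sobolev space $W_p^2(\mathbb R^n)$, let $A$, $B$ be the operators of multiplication by $a$, $b$ in $L_p(\mathbb R^n)$ with maximal domains, and let $H$ be the Schrödinger operator, i.e. the closed extension of $H_0+AB$ determined by $$(H-z)^{-1}=R(z)-\overline{R(z)A}\,\bigl(I+Q(z)\bigr)^{-1}\,\overline{BR(z)},\qquad R(z)=(H_0-z)^{-1},\quad Q(z)=\overline{BR(z)A},$$ for a regular point $z$ of $H_0$ such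 that $I+Q(z)$ is boundedly invertible; here the bars denote bounded extensions of densely defined operators to $L_p(\mathbb R^n)$. Then every eigenvalue $\lambda$ of $H$ with $\operatorname{Re}\lambda<0$ satisfies $$|\operatorname{Re}\lambda|^{1-\frac{n}{2\alpha'}}\le(4\pi)^{-\frac{n}{2\alpha'}}\,\alpha^{-\frac{n}{2\alpha}}\,\Gamma\Bigl(1-\frac{n}{2\alpha'}\Bigr)\,\|a\|_r\,\|b\|_s,$$ where $\alpha=\bigl(1-\frac1r-\frac1s\bigr)^{-1}$ and $\frac1{\alpha'}=1-\frac1\alpha$. -/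

import Mathlib

open MeasureTheory
open scoped ENNReal SchwartzMap Laplacian LineDeriv

noncomputable section

namespace SchrodingerLp

/-! ### Partially defined operators -/

section Operators

variable {X : Type*} [NormedAddCommGroup X] [NormedSpace ℂ X]

/-- The composition `g f` of two unbounded operators, on its maximal domain
`{x ∈ D(f) : f x ∈ D(g)}`. -/
def pcomp (g f : X →ₗ.[ℂ] X) : X →ₗ.[ℂ] X where
  domain :=
    { carrier := {x | ∃ hx : x ∈ f.domain, f ⟨x, hx⟩ ∈ g.domain}
      add_mem' := by
        rintro x y ⟨hx, hx'⟩ ⟨hy, hy'⟩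
        refine ⟨f.domain.add_mem hx hy, ?_⟩
        have h : f ⟨x + y, f.domain.add_mem hx hy⟩ = f ⟨x, hx⟩ + f ⟨y, hy⟩ :=
          f.map_add ⟨x, hx⟩ ⟨y, hy⟩
        rw [h]
        exact g.domain.add_mem hx' hy'
      zero_mem' := by
        refine ⟨f.domain.zero_mem, ?_⟩
        have h : f ⟨0, f.domain.zero_mem⟩ = 0 := f.map_zero
        rw [h]
        exact g.domain.zero_mem
      smul_mem' := by
        rintro c x ⟨hx, hx'⟩
        refine ⟨f.domain.smul_mem c hx, ?_⟩
        have h : f ⟨c • x, f.domain.smul_mem c hx⟩ = c • f ⟨x, hx⟩ :=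
          f.map_smul c ⟨x, hx⟩
        rw [h]
        exact g.domain.smul_mem c hx' }
  toFun :=
    { toFun := fun x => g ⟨f ⟨x, x.2.choose⟩, x.2.choose_spec⟩
      map_add' := by
        intro x y
        rw [← g.map_add]
        congr 1
        exact Subtype.ext (f.map_add ⟨x, x.2.choose⟩ ⟨y, y.2.choose⟩)
      map_smul' := by
        intro c x
        rw [RingHom.id_apply, ← g.map_smul]
        congr 1
        exact Subtype.ext (f.map_smul c ⟨x, x.2.choose⟩) }

/-- An everywhere defined bounded operator, seen as an unbounded operator with full domain. -/
def full (R : X →L[ℂ] X) : X →ₗ.[ℂ] X := (R : X →ₗ[ℂ] X).toPMap ⊤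

/-- `R` is the resolvent `(T - z)⁻¹`, a bounded operator which is a two-sided inverse of
`T - z : D(T) → X`. In particular `z` is a regular point of `T`. -/
def IsResolvent (T : X →ₗ.[ℂ] X) (z : ℂ) (R : X →L[ℂ] X) : Prop :=
  (∀ u : X, ∃ hu : R u ∈ T.domain, T ⟨R u, hu⟩ - z • R u = u) ∧
    ∀ f : T.domain, R (T f - z • (f : X)) = f

/-- `S` is the (necessarily unique) bounded extension to the whole space of the densely
defined operator `T`. -/
def IsBoundedExtension (T : X →ₗ.[ℂ] X) (S : X →L[ℂ] X) : Prop :=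
  Dense (T.domain : Set X) ∧ ∀ x : T.domain, S x = T x

/-- `ev` is an eigenvalue of the unbounded operator `T`. -/
def IsEigenvalue (T : X →ₗ.[ℂ] X) (ev : ℂ) : Prop :=
  ∃ f : T.domain, (f : X) ≠ 0 ∧ T f = ev • (f : X)

end Operators

/-! ### The operators on `L_p(ℝⁿ)` -/

section Lebesgue

variable {n : ℕ}

/-- The space `L_p(ℝⁿ)` of complex valued functions, with respect to Lebesgue measure. -/
abbrev LpSpace (n : ℕ) (p : ℝ≥0∞) : Type :=
  Lp ℂ p (volume : Measure (EuclideanSpace ℝ (Fin n)))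

theorem mul_add_ae {p : ℝ≥0∞} (a : EuclideanSpace ℝ (Fin n) → ℂ) (u v : LpSpace n p) :
    (fun x => a x * u x) + (fun x => a x * v x) =ᵐ[volume]
      fun x => a x * (u + v : LpSpace n p) x := by
  filter_upwards [Lp.coeFn_add u v] with x hx
  rw [hx, Pi.add_apply, Pi.add_apply, mul_add]

theorem mul_smul_ae {p : ℝ≥0∞} (a : EuclideanSpace ℝ (Fin n) → ℂ) (c : ℂ) (u : LpSpace n p) :
    (c • fun x => a x * u x) =ᵐ[volume] fun x => a x * (c • u : LpSpace n p) x := by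
  filter_upwards [Lp.coeFn_smul c u] with x hx
  rw [hx, Pi.smul_apply, Pi.smul_apply, smul_eq_mul, smul_eq_mul, mul_left_comm]

theorem mul_zero_ae {p : ℝ≥0∞} (a : EuclideanSpace ℝ (Fin n) → ℂ) :
    (fun _ => 0 : EuclideanSpace ℝ (Fin n) → ℂ) =ᵐ[volume]
      fun x => a x * (0 : LpSpace n p) x := by
  filter_upwards [Lp.coeFn_zero ℂ p (volume : Measure (EuclideanSpace ℝ (Fin n)))] with x hx
  rw [hx, Pi.zero_apply, mul_zero]

/-- The maximal domain `{u ∈ L_p : a u ∈ L_p}` of the multiplication by `a` in `L_p(ℝⁿ)`. -/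
def mulDomain (p : ℝ≥0∞) (a : EuclideanSpace ℝ (Fin n) → ℂ) : Submodule ℂ (LpSpace n p) where
  carrier := {u | MemLp (fun x => a x * u x) p volume}
  add_mem' := fun {u v} hu hv => (MemLp.add hu hv).ae_eq (mul_add_ae a u v)
  zero_mem' := MemLp.zero.ae_eq (mul_zero_ae a)
  smul_mem' := fun c u hu => (MemLp.const_smul hu c).ae_eq (mul_smul_ae a c u)

theorem toLp_mul_add {p : ℝ≥0∞} (a : EuclideanSpace ℝ (Fin n) → ℂ) (u v : LpSpace n p)
    (hu : MemLp (fun x => a x * u x) p volume) (hv : MemLp (fun x => a x * v x) p volume)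
    (huv : MemLp (fun x => a x * (u + v : LpSpace n p) x) p volume) :
    huv.toLp _ = hu.toLp _ + hv.toLp _ := by
  rw [← MemLp.toLp_add hu hv]
  exact MemLp.toLp_congr _ _ (mul_add_ae a u v).symm

theorem toLp_mul_smul {p : ℝ≥0∞} (a : EuclideanSpace ℝ (Fin n) → ℂ) (c : ℂ) (u : LpSpace n p)
    (hu : MemLp (fun x => a x * u x) p volume)
    (hcu : MemLp (fun x => a x * (c • u : LpSpace n p) x) p volume) :
    hcu.toLp _ = c • hu.toLp _ := by
  rw [← MemLp.toLp_const_smul c hu]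
  exact MemLp.toLp_congr _ _ (mul_smul_ae a c u).symm

/-- The operator of multiplication by `a` in `L_p(ℝⁿ)`, on its maximal domain. -/
def mulOp (p : ℝ≥0∞) (a : EuclideanSpace ℝ (Fin n) → ℂ) :
    LpSpace n p →ₗ.[ℂ] LpSpace n p where
  domain := mulDomain p a
  toFun :=
    { toFun := fun u => MemLp.toLp (fun x => a x * (u : LpSpace n p) x) u.2
      map_add' := by
        rintro ⟨u, hu⟩ ⟨v, hv⟩
        exact toLp_mul_add a u v hu hv _
      map_smul' := by
        rintro c ⟨u, hu⟩
        exact toLp_mul_smul a c u hu _ }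

variable {p : ℝ≥0∞} [Fact (1 ≤ p)]

/-- The tempered distribution `u` is (represented by) a function of `L_p(ℝⁿ)`. -/
def DistMemLp (p : ℝ≥0∞) [Fact (1 ≤ p)] (u : 𝓢'(EuclideanSpace ℝ (Fin n), ℂ)) : Prop :=
  ∃ v : LpSpace n p, (v : 𝓢'(EuclideanSpace ℝ (Fin n), ℂ)) = u

/-- The Sobolev space `W_p²(ℝⁿ)`: all `u ∈ L_p(ℝⁿ)` whose distributional partial derivatives of
first and second order are functions in `L_p(ℝⁿ)`. -/
def IsSobolevTwo (u : LpSpace n p) : Prop :=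
  (∀ i : Fin n, DistMemLp p
    (∂_{EuclideanSpace.basisFun (Fin n) ℝ i} (u : 𝓢'(EuclideanSpace ℝ (Fin n), ℂ)))) ∧
  ∀ i j : Fin n, DistMemLp p
    (∂_{EuclideanSpace.basisFun (Fin n) ℝ i} (∂_{EuclideanSpace.basisFun (Fin n) ℝ j}
      (u : 𝓢'(EuclideanSpace ℝ (Fin n), ℂ))))

theorem toDist_add (u v : LpSpace n p) :
    ((u + v : LpSpace n p) : 𝓢'(EuclideanSpace ℝ (Fin n), ℂ)) = u + v :=
  (Lp.toTemperedDistributionCLM ℂ volume p).map_add u v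

theorem toDist_smul (c : ℂ) (u : LpSpace n p) :
    ((c • u : LpSpace n p) : 𝓢'(EuclideanSpace ℝ (Fin n), ℂ)) =
      c • (u : 𝓢'(EuclideanSpace ℝ (Fin n), ℂ)) :=
  (Lp.toTemperedDistributionCLM ℂ volume p).map_smul c u

theorem toDist_zero : ((0 : LpSpace n p) : 𝓢'(EuclideanSpace ℝ (Fin n), ℂ)) = 0 :=
  (Lp.toTemperedDistributionCLM ℂ volume p).map_zero

theorem toDist_injective :
    Function.Injective (fun u : LpSpace n p => (u : 𝓢'(EuclideanSpace ℝ (Fin n), ℂ))) :=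
  LinearMap.ker_eq_bot.1 (Lp.ker_toTemperedDistributionCLM_eq_bot (F := ℂ)
    (μ := (volume : Measure (EuclideanSpace ℝ (Fin n)))) (p := p))

theorem DistMemLp.add {u v : 𝓢'(EuclideanSpace ℝ (Fin n), ℂ)}
    (hu : DistMemLp p u) (hv : DistMemLp p v) : DistMemLp p (u + v) := by
  obtain ⟨u', rfl⟩ := hu
  obtain ⟨v', rfl⟩ := hv
  exact ⟨u' + v', toDist_add u' v'⟩

theorem DistMemLp.smul (c : ℂ) {u : 𝓢'(EuclideanSpace ℝ (Fin n), ℂ)}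
    (hu : DistMemLp p u) : DistMemLp p (c • u) := by
  obtain ⟨u', rfl⟩ := hu
  exact ⟨c • u', toDist_smul c u'⟩

theorem DistMemLp.zero : DistMemLp p (0 : 𝓢'(EuclideanSpace ℝ (Fin n), ℂ)) :=
  ⟨0, toDist_zero⟩

/-- `W_p²(ℝⁿ)` as a linear subspace of `L_p(ℝⁿ)`. -/
def sobolevTwo (n : ℕ) (p : ℝ≥0∞) [Fact (1 ≤ p)] : Submodule ℂ (LpSpace n p) where
  carrier := {u | IsSobolevTwo u}
  add_mem' := by
    rintro u v ⟨hu, hu'⟩ ⟨hv, hv'⟩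
    refine ⟨fun i => ?_, fun i j => ?_⟩
    · rw [toDist_add, LineDeriv.lineDerivOp_add]
      exact (hu i).add (hv i)
    · rw [toDist_add, LineDeriv.lineDerivOp_add, LineDeriv.lineDerivOp_add]
      exact (hu' i j).add (hv' i j)
  zero_mem' := by
    refine ⟨fun i => ?_, fun i j => ?_⟩
    · rw [toDist_zero, LineDeriv.lineDerivOp_zero]
      exact DistMemLp.zero
    · rw [toDist_zero, LineDeriv.lineDerivOp_zero, LineDeriv.lineDerivOp_zero]
      exact DistMemLp.zero
  smul_mem' := by
    rintro c u ⟨hu, hu'⟩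
    refine ⟨fun i => ?_, fun i j => ?_⟩
    · rw [toDist_smul, LineDeriv.lineDerivOp_smul]
      exact (hu i).smul c
    · rw [toDist_smul, LineDeriv.lineDerivOp_smul, LineDeriv.lineDerivOp_smul]
      exact (hu' i j).smul c

theorem exists_neg_laplacian (u : sobolevTwo n p) :
    ∃ v : LpSpace n p, (v : 𝓢'(EuclideanSpace ℝ (Fin n), ℂ)) =
      -Δ ((u : LpSpace n p) : 𝓢'(EuclideanSpace ℝ (Fin n), ℂ)) := by
  have h : DistMemLp p (Δ ((u : LpSpace n p) : 𝓢'(EuclideanSpace ℝ (Fin n), ℂ))) := by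
    rw [TemperedDistribution.laplacian_eq_sum (EuclideanSpace.basisFun (Fin n) ℝ)]
    exact Finset.sum_induction _ (DistMemLp p) (fun _ _ => DistMemLp.add) DistMemLp.zero
      (fun i _ => u.2.2 i i)
  obtain ⟨v, hv⟩ := h
  exact ⟨-v, by rw [← hv]; exact (Lp.toTemperedDistributionCLM ℂ volume p).map_neg v⟩

/-- The unperturbed operator `H₀`: the operator `-Δ` in `L_p(ℝⁿ)` with domain `W_p²(ℝⁿ)`. -/
def freeOp (n : ℕ) (p : ℝ≥0∞) [Fact (1 ≤ p)] : LpSpace n p →ₗ.[ℂ] LpSpace n p where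
  domain := sobolevTwo n p
  toFun :=
    { toFun := fun u => (exists_neg_laplacian u).choose
      map_add' := by
        intro u v
        apply toDist_injective
        simp only [toDist_add]
        rw [(exists_neg_laplacian (u + v)).choose_spec, (exists_neg_laplacian u).choose_spec,
          (exists_neg_laplacian v).choose_spec, Submodule.coe_add, toDist_add]
        simp only [← TemperedDistribution.laplacianCLM_apply, map_add, neg_add]
      map_smul' := by
        intro c u
        apply toDist_injective
        simp only [toDist_smul, RingHom.id_apply]
        rw [(exists_neg_laplacian (c • u)).choose_spec, (exists_neg_laplacian u).choose_spec,
          Submodule.coe_smul, toDist_smul]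
        simp only [← TemperedDistribution.laplacianCLM_apply, map_smul, smul_neg] }

theorem mulOp_ae (a : EuclideanSpace ℝ (Fin n) → ℂ) (u : (mulOp p a).domain) :
   (mulOp p a u : LpSpace n p) =ᵐ[volume] fun x => a x * (u : LpSpace n p) x :=
  MemLp.coeFn_toLp u.2

/-- Multiplication operators are closed. -/
theorem closed_mul (b : EuclideanSpace ℝ (Fin n) → ℂ) (u : ℕ → (mulOp p b).domain)
    (x y : LpSpace n p) (hx : Filter.Tendsto (fun k => (u k : LpSpace n p)) Filter.atTop (nhds x))
    (hy : Filter.Tendsto (fun k => mulOp p b (u k)) Filter.atTop (nhds y)) :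
    ∃ h : x ∈ (mulOp p b).domain, mulOp p b ⟨x, h⟩ = y := by
  have h1 := tendstoInMeasure_of_tendsto_Lp hx
  obtain ⟨φ, hφ, h2⟩ := h1.exists_seq_tendsto_ae
  have h3 := tendstoInMeasure_of_tendsto_Lp (hy.comp hφ.tendsto_atTop)
  obtain ⟨ψ, hψ, h4⟩ := h3.exists_seq_tendsto_ae
  have key : (fun t => b t * x t) =ᵐ[volume] y := by
    have h5 : ∀ᵐ t ∂volume, ∀ k, (mulOp p b (u k) : LpSpace n p) t = b t * (u k : LpSpace n p) t :=
      ae_all_iff.2 fun k => mulOp_ae b (u k)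
    filter_upwards [h2, h4, h5] with t a1 a2 a3
    have a4 := (a1.comp hψ.tendsto_atTop).const_mul (b t)
    refine tendsto_nhds_unique a4 ?_
    refine a2.congr fun k => ?_
    simp [a3]
  have hm : x ∈ (mulOp p b).domain := (Lp.memLp y).ae_eq key.symm
  refine ⟨hm, ?_⟩
  apply Lp.ext
  exact (mulOp_ae b ⟨x, hm⟩).trans key

theorem extension_spec {b : EuclideanSpace ℝ (Fin n) → ℂ} {T : LpSpace n p →ₗ.[ℂ] LpSpace n p}
    {G Q : LpSpace n p →L[ℂ] LpSpace n p}
    (hG : ∀ x : T.domain, G x = T x)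
    (hQ : IsBoundedExtension (pcomp (mulOp p b) T) Q) (v : LpSpace n p) :
    ∃ h : G v ∈ (mulOp p b).domain, mulOp p b ⟨G v, h⟩ = Q v := by
  obtain ⟨u, hu, hv⟩ := mem_closure_iff_seq_limit.1 (hQ.1 v)
  have hT : ∀ k, G (u k) ∈ (mulOp p b).domain := fun k => by
    obtain ⟨h1, h2⟩ := hu k
    rw [hG ⟨u k, h1⟩]; exact h2
  refine closed_mul b (fun k => ⟨G (u k), hT k⟩) _ _ ((G.continuous.tendsto v).comp hv) ?_
  refine ((Q.continuous.tendsto v).comp hv).congr fun k => ?_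
  have := hQ.2 ⟨u k, hu k⟩
  simp only [Function.comp]
  refine this.trans ?_
  obtain ⟨h1, h2⟩ := hu k
  show mulOp p b ⟨T ⟨u k, _⟩, _⟩ = _
  congr 1
  exact Subtype.ext (hG ⟨u k, h1⟩).symm

/-- The operator `S = R - G (I + Q)⁻¹ K` is injective, so that `z + S⁻¹` is a well defined operator. -/
theorem resolventFormula_injective {a b : EuclideanSpace ℝ (Fin n) → ℂ} {z : ℂ} {R K G Q : LpSpace n p →L[ℂ] LpSpace n p}
    (hR : IsResolvent (freeOp n p) z R)
    (hK : IsBoundedExtension (pcomp (mulOp p b) (full R)) K)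
    (hG : IsBoundedExtension (pcomp (full R) (mulOp p a)) G)
    (hQ : IsBoundedExtension (pcomp (mulOp p b) (pcomp (full R) (mulOp p a))) Q)
    (hU : IsUnit (1 + Q)) (u : LpSpace n p)
    (h0 : (R - G * Ring.inverse (1 + Q) * K) u = 0) : u = 0 := by
  set w := Ring.inverse (1 + Q) (K u) with hw
  have e1 : R u = G w := by simpa [sub_eq_zero] using h0
  obtain ⟨h1, h2⟩ := extension_spec hG.2 hQ w
  obtain ⟨h3, h4⟩ := extension_spec (T := full R) (G := R) (fun x => rfl) hK u
  have e2 : K u = Q w := by rw [← h4, ← h2]; congr 1; exact Subtype.ext e1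
  have e3 : (1 + Q) w = K u := by
    have := Ring.mul_inverse_cancel _ hU
    have := DFunLike.congr_fun this (K u)
    simpa using this
  have e4 : w = 0 := by
    rw [e2] at e3
    simpa using e3
  rw [e4, map_zero] at e1
  obtain ⟨h5, h6⟩ := hR.1 u
  have : freeOp n p ⟨R u, h5⟩ = 0 := by
    have : (⟨R u, h5⟩ : (freeOp n p).domain) = 0 := Subtype.ext e1
    rw [this]; exact (freeOp n p).map_zero
  rw [this, e1] at h6; simpa using h6.symm

/-- `H` is the Schrödinger operator in `L_p(ℝⁿ)` that the factorization `q = a b` associates with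
the differential expression `-Δ + q`.

Let `A`, `B` be the operators of multiplication by `a`, `b`. For a regular point `z` of `H₀` with
resolvent `R = R(z; H₀)`, let `K`, `G`, `Q` be the bounded extensions of `B R`, `R A` and of the
bordered resolvent `B R A`. If `I + Q` is boundedly invertible, then
`S = R - G (I + Q)⁻¹ K` is the resolvent of `H` at `z`, that is `H = z + S⁻¹`. (The operator does
not depend on the choice of `z`.) -/
def IsSchrodingerOp (p : ℝ≥0∞) [Fact (1 ≤ p)] (a b : EuclideanSpace ℝ (Fin n) → ℂ)
    (H : LpSpace n p →ₗ.[ℂ] LpSpace n p) : Prop :=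
  ∃ (z : ℂ) (R K G Q : LpSpace n p →L[ℂ] LpSpace n p),
    IsResolvent (freeOp n p) z R ∧
    IsBoundedExtension (pcomp (mulOp p b) (full R)) K ∧
    IsBoundedExtension (pcomp (full R) (mulOp p a)) G ∧
    IsBoundedExtension (pcomp (mulOp p b) (pcomp (full R) (mulOp p a))) Q ∧
    IsUnit (1 + Q) ∧
    H = (z • (LinearMap.id : LpSpace n p →ₗ[ℂ] LpSpace n p)) +ᵥ
      (full (R - G * Ring.inverse (1 + Q) * K)).inverse

/-- The Schrödinger operator extends `H₀ + A B`. -/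
theorem extends_sum {a b : EuclideanSpace ℝ (Fin n) → ℂ} {H : LpSpace n p →ₗ.[ℂ] LpSpace n p}
    (hH : IsSchrodingerOp p a b H) :
    freeOp n p + pcomp (mulOp p a) (mulOp p b) ≤ H := by
  obtain ⟨z, R, K, G, Q, hR, hK, hG, hQ, hU, rfl⟩ := hH
  have hker : (full (R - G * Ring.inverse (1 + Q) * K)).toFun.ker = ⊥ := by
    rw [LinearMap.ker_eq_bot']
    rintro ⟨u, hu⟩ h
    exact Subtype.ext (resolventFormula_injective hR hK hG hQ hU u h)
  set S := R - G * Ring.inverse (1 + Q) * K with hS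
  have main : ∀ f : (freeOp n p + pcomp (mulOp p a) (mulOp p b)).domain,
      S ((freeOp n p + pcomp (mulOp p a) (mulOp p b)) f - z • (f : LpSpace n p)) = f := by
    rintro ⟨f, hf0, hfB, hfA⟩
    have e : (freeOp n p + pcomp (mulOp p a) (mulOp p b)) ⟨f, hf0, hfB, hfA⟩
      = freeOp n p ⟨f, hf0⟩ + mulOp p a ⟨mulOp p b ⟨f, hfB⟩, hfA⟩ := rfl
    rw [e]
    set w := mulOp p b ⟨f, hfB⟩ with hw
    set g := freeOp n p ⟨f, hf0⟩ + mulOp p a ⟨w, hfA⟩ - z • f with hg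
    have hGw : R (mulOp p a ⟨w, hfA⟩) = G w :=
      (hG.2 ⟨w, hfA, trivial⟩).symm
    have hRg : R g = f + G w := by
      have := hR.2 ⟨f, hf0⟩
      rw [hg, add_sub_right_comm, map_add, this, hGw]
    obtain ⟨h1, h2⟩ := extension_spec hG.2 hQ w
    obtain ⟨h3, h4⟩ := extension_spec (T := full R) (G := R) (fun x => rfl) hK g
    have hKg : K g = (1 + Q) w := by
      rw [← h4]
      have : (⟨R g, h3⟩ : (mulOp p b).domain) = ⟨f, hfB⟩ + ⟨G w, h1⟩ := Subtype.ext hRg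
      rw [this, (mulOp p b).map_add, h2]
      simp [hw]
    have e3 : Ring.inverse (1 + Q) (K g) = w := by
      have := DFunLike.congr_fun (Ring.inverse_mul_cancel _ hU) w
      rw [hKg]; simpa using this
    simp only [hS]
    simp [e3, hRg]
  refine ⟨fun f hf => ?_, ?_⟩
  · change f ∈ (full S).inverse.domain
    rw [LinearPMap.inverse_domain]
    exact ⟨⟨_, trivial⟩, main ⟨f, hf⟩⟩
  · rintro f ⟨y, hy⟩ hfy
    obtain rfl : (f : LpSpace n p) = y := hfy
    have := LinearPMap.inverse_apply_eq hker (y := ⟨f, hy⟩) (x := ⟨(freeOp n p + pcomp (mulOp p a) (mulOp p b)) f - z • (f : LpSpace n p), trivial⟩) (main f)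
    change _ = z • (f : LpSpace n p) + _
    have h' : (full S).inverse.toFun ⟨f, hy⟩ = _ := this
    rw [h']
    exact (add_sub_cancel _ _).symm
/-- The Stummel quantity
`M_{ν,t}(u) = sup_x ∫_{|x - y| < 1} |u(y)|^t |x - y|^(ν - n) dy`. -/
def stummel (ν t : ℝ) (u : EuclideanSpace ℝ (Fin n) → ℂ) : ℝ≥0∞ :=
  ⨆ x : EuclideanSpace ℝ (Fin n),
    ∫⁻ y in Metric.ball x 1, ‖u y‖ₑ ^ t * edist x y ^ (ν - (n : ℝ))

end Lebesgue

end SchrodingerLp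

end

noncomputable section

namespace SchrodingerLp

/-! Let `κ = -Re ev > 0`. The resolvent formula turns `H f = ev f` into `f = R g - G w`, where `g =
(ev - z) f` and `w = (1 + Q)⁻¹ K g`. Applying `B` gives `B f = K g - Q w = w`. So `v = b f` lies in
`L_p`, and `-Δ f - ev f = -a v` holds in the sense of distributions (`exists_eigenfunction`).

The free resolvent is the Laplace transform of the heat semigroup, and `|exp (ev t)| = exp (-κ t)`.
Duality therefore gives `|f| ≤ k * |a v|` almost everywhere, where `k = ∫ exp (-κ t) h_t dt` is a
positive kernel and `h_t` is the heat kernel (`ae_enorm_le_conv`). Minkowski's inequality gives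
`‖k‖_α ≤ ∫ exp (-κ t) ‖h_t‖_α dt`. Since `‖h_t‖_α = (4πt)^(-n/(2α')) α^(-n/(2α))`, this is a Gamma
integral. It converges because `n/(2α') < 1`, and it produces the constant of the theorem
(`lintegral_greenKernel_rpow_le`).

Hölder for `a v`, Young for `k * |a v|` and Hölder for `b f` return to the exponent of departure:
`‖v‖_q ≤ ‖b‖_s ‖k‖_α ‖a‖_r ‖v‖_q`. As `0 < ‖v‖_q < ∞`, division by `‖v‖_q` is the claim
(`one_le_of_ae_enorm_le_conv`). If `1/r + 1/p ≤ 1`, take `q = p`. Otherwise `a v` need not lie in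
any `L_σ` with `σ ≥ 1` by Hölder alone. In that case the Stummel condition on `a` and the
exponential decay of `k` first give `f ∈ L_α` (`memLp_of_ae_enorm_le_conv`), and `q = r'` is used.
-/

/-! ### The free resolvent on Schwartz functions -/

/-- Only the values of `g` on a compact interval matter, and there all its derivatives are bounded.
-/
theorem hasTemperateGrowth_comp_of_isCompact {D F : Type*} [NormedAddCommGroup D]
    [NormedSpace ℝ D] [NormedAddCommGroup F] [NormedSpace ℝ F] {g : ℝ → F} {f : D → ℝ}
    {l u : ℝ} (hlu : l < u) (hr : ∀ x, f x ∈ Set.Icc l u) (hg : ContDiff ℝ (⊤ : ℕ∞) g)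
    (hf : f.HasTemperateGrowth) : (fun x => g (f x)).HasTemperateGrowth := by
  refine Function.HasTemperateGrowth.comp' (g := g) (t := Set.Icc l u)
    (by rintro _ ⟨x, rfl⟩; exact hr x) (uniqueDiffOn_Icc hlu) hg.contDiffOn ?_ hf
  intro N
  have hb : ∀ k : ℕ, ∃ C, ∀ x ∈ Set.Icc l u, ‖iteratedFDerivWithin ℝ k g (Set.Icc l u) x‖ ≤ C := by
    intro k
    refine isCompact_Icc.exists_bound_of_continuousOn
      (hg.contDiffOn.continuousOn_iteratedFDerivWithin (m := k) ?_ (uniqueDiffOn_Icc hlu))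
    exact_mod_cast le_top
  choose C hC using hb
  refine ⟨0, ∑ k ∈ Finset.range (N + 1), |C k|, Finset.sum_nonneg fun _ _ => abs_nonneg _, ?_⟩
  intro k hk x hx
  rw [pow_zero, mul_one]
  exact (hC k x hx).trans ((le_abs_self _).trans (Finset.single_le_sum (f := fun k => |C k|)
    (fun _ _ => abs_nonneg _) (Finset.mem_range.2 (by omega))))

theorem norm_sq_sub_ne_zero {ev : ℂ} (hre : ev.re < 0) (c : ℝ) (hc : 0 ≤ c) :
    (c : ℂ) - ev ≠ 0 := by
  intro h
  have := congrArg Complex.re h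
  simp at this
  linarith

variable {n : ℕ}

/-- The symbol of the resolvent of the negative Laplacian. -/
def resolventSymbol (ev : ℂ) (ξ : EuclideanSpace ℝ (Fin n)) : ℂ :=
  (((2 * Real.pi) ^ 2 * ‖ξ‖ ^ 2 : ℝ) - ev)⁻¹

/-- With `y = 1 + ‖c ξ‖²` and `c = 2π/√κ`, the denominator of the symbol is `κ y - i Im ev`. The
symbol is thus a smooth function of `u = 1/y ∈ [0, 1]`, namely `u / (κ - i (Im ev) u)`, and `1/y`
has temperate growth. -/
theorem hasTemperateGrowth_resolventSymbol {ev : ℂ} (hre : ev.re < 0) :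
    (resolventSymbol ev : EuclideanSpace ℝ (Fin n) → ℂ).HasTemperateGrowth := by
  set κ := -ev.re with hκ
  have hκ0 : 0 < κ := by linarith
  set c := 2 * Real.pi / √κ with hc
  have h1 : (fun ξ : EuclideanSpace ℝ (Fin n) =>
      (1 + ‖c • ξ‖ ^ 2) ^ (-1 : ℝ)).HasTemperateGrowth :=
    (Function.hasTemperateGrowth_one_add_norm_sq_rpow (EuclideanSpace ℝ (Fin n)) (-1)).comp
      ((c • ContinuousLinearMap.id ℝ (EuclideanSpace ℝ (Fin n))).hasTemperateGrowth)
  have hne : ∀ u : ℝ, (κ : ℂ) - Complex.I * ev.im * u ≠ 0 := fun u h => by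
    have := congrArg Complex.re h
    simp at this
    linarith
  have hg : ContDiff ℝ (⊤ : ℕ∞) fun u : ℝ => (u : ℂ) * ((κ : ℂ) - Complex.I * ev.im * u)⁻¹ := by
    have hu : ContDiff ℝ (⊤ : ℕ∞) fun u : ℝ => (u : ℂ) := Complex.ofRealCLM.contDiff
    exact hu.mul ((contDiff_const.sub (contDiff_const.mul hu)).inv hne)
  have := hasTemperateGrowth_comp_of_isCompact (l := 0) (u := 1) one_pos ?_ hg h1
  · convert! this using 2 with ξ
    have h2 : (0 : ℝ) < 1 + ‖c • ξ‖ ^ 2 := by positivity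
    have h3 : (2 * Real.pi) ^ 2 * ‖ξ‖ ^ 2 = κ * (1 + ‖c • ξ‖ ^ 2) - κ := by
      rw [norm_smul, mul_pow ‖c‖, Real.norm_eq_abs, sq_abs, hc, div_pow, Real.sq_sqrt hκ0.le]
      field_simp
      ring
    rw [resolventSymbol, h3, Real.rpow_neg_one, Complex.ofReal_inv]
    set y := 1 + ‖c • ξ‖ ^ 2
    have hy : (y : ℂ) ≠ 0 := by exact_mod_cast h2.ne'
    have hev : ev = -κ + ev.im * Complex.I := by
      apply Complex.ext <;> simp [hκ]
    rw [← mul_inv_rev, inv_inj]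
    rw [sub_mul, mul_assoc _ _ (y : ℂ), inv_mul_cancel₀ hy]
    conv_lhs => rw [hev]
    push_cast
    ring
  · intro ξ
    have h2 : (1 : ℝ) ≤ 1 + ‖c • ξ‖ ^ 2 := by nlinarith [sq_nonneg ‖c • ξ‖]
    rw [Real.rpow_neg_one]
    exact ⟨by positivity, inv_le_one_of_one_le₀ h2⟩

/-- The resolvent of the negative Laplacian on Schwartz functions. -/
def schwartzResolvent (ev : ℂ) (φ : 𝓢(EuclideanSpace ℝ (Fin n), ℂ)) :
    𝓢(EuclideanSpace ℝ (Fin n), ℂ) :=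
  SchwartzMap.fourierMultiplierCLM ℂ (resolventSymbol ev) φ

theorem laplacian_schwartzResolvent {ev : ℂ} (hre : ev.re < 0)
    (φ : 𝓢(EuclideanSpace ℝ (Fin n), ℂ)) :
    -Δ (schwartzResolvent ev φ) - ev • schwartzResolvent ev φ = φ := by
  have hm := hasTemperateGrowth_resolventSymbol (n := n) hre
  have ht : (fun ξ : EuclideanSpace ℝ (Fin n) => ((‖ξ‖ ^ 2 : ℝ) : ℂ)).HasTemperateGrowth := by
    fun_prop
  have hs : (‖·‖ ^ 2 : EuclideanSpace ℝ (Fin n) → ℝ).HasTemperateGrowth := by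
    simpa using! Function.hasTemperateGrowth_norm_sq (H := EuclideanSpace ℝ (Fin n))
  have e1 : Δ (schwartzResolvent ev φ) = -((2 * Real.pi) ^ 2 : ℝ) •
      SchwartzMap.fourierMultiplierCLM ℂ
        ((fun ξ : EuclideanSpace ℝ (Fin n) => ((‖ξ‖ ^ 2 : ℝ) : ℂ)) * resolventSymbol ev) φ := by
    rw [SchwartzMap.laplacian_eq_fourierMultiplierCLM,
      ← SchwartzMap.fourierMultiplierCLM_ofReal ℂ hs, schwartzResolvent]
    congr 1
    exact SchwartzMap.fourierMultiplierCLM_fourierMultiplierCLM_apply ht hm φ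
  have e2 : SchwartzMap.fourierMultiplierCLM ℂ
      (fun _ : EuclideanSpace ℝ (Fin n) => (1 : ℂ)) φ = φ := by simp
  rw [e1, schwartzResolvent]
  conv_rhs => rw [← e2]
  rw [SchwartzMap.fourierMultiplierCLM_apply, SchwartzMap.fourierMultiplierCLM_apply,
    SchwartzMap.fourierMultiplierCLM_apply, neg_smul, neg_neg]
  set φ' := FourierTransform.fourier φ
  have e3 : ((2 * Real.pi) ^ 2 : ℝ) • SchwartzMap.smulLeftCLM ℂ
      ((fun ξ : EuclideanSpace ℝ (Fin n) => ((‖ξ‖ ^ 2 : ℝ) : ℂ)) * resolventSymbol ev) φ' -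
      ev • SchwartzMap.smulLeftCLM ℂ (resolventSymbol ev) φ' =
      SchwartzMap.smulLeftCLM ℂ (fun _ : EuclideanSpace ℝ (Fin n) => (1 : ℂ)) φ' := by
    ext ξ
    have h0 := norm_sq_sub_ne_zero hre ((2 * Real.pi) ^ 2 * ‖ξ‖ ^ 2) (by positivity)
    rw [sub_apply, smul_apply, smul_apply,
      SchwartzMap.smulLeftCLM_apply_apply (ht.mul hm), SchwartzMap.smulLeftCLM_apply_apply hm,
      SchwartzMap.smulLeftCLM_apply_apply (Function.HasTemperateGrowth.const 1), Pi.mul_apply,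
      resolventSymbol, Complex.real_smul]
    simp only [smul_eq_mul, ← mul_assoc, ← sub_mul, ← Complex.ofReal_mul]
    rw [mul_inv_cancel₀ h0]
  rw [← e3, sub_eq_add_neg _ (ev • SchwartzMap.smulLeftCLM ℂ (resolventSymbol ev) φ'), ← neg_smul,
    FourierTransform.fourierInv_add, FourierTransform.fourierInv_smul,
    FourierTransform.fourierInv_smul, neg_smul, ← sub_eq_add_neg]

/-! ### Heat kernels and the Green kernel -/

/-- The heat kernel, with the constant `4` in the exponent replaced by `D`. -/
def heatKernel (D t : ℝ) (x : EuclideanSpace ℝ (Fin n)) : ℝ :=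
  (4 * Real.pi * t) ^ (-((n : ℝ) / 2)) * Real.exp (-(‖x‖ ^ 2 / (D * t)))

-- The multiplication formula `∫ Ĝ φ = ∫ G φ̂` for a Gaussian `G` times a character; `Ĝ` is the heat
-- kernel centred at `y`.
open FourierTransform in
theorem integral_fourier_heat {t : ℝ} (ht : 0 < t) (φ : 𝓢(EuclideanSpace ℝ (Fin n), ℂ))
    (y : EuclideanSpace ℝ (Fin n)) :
    ∫ ξ, Complex.exp (2 * Real.pi * Complex.I * (inner ℝ y ξ : ℝ)) *
      Complex.exp (-((4 * Real.pi ^ 2 * t : ℝ) : ℂ) * ‖ξ‖ ^ 2) * 𝓕 φ ξ =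
      ∫ x, (heatKernel 4 t (y - x) : ℂ) * φ x := by
  set b : ℂ := ((4 * Real.pi ^ 2 * t : ℝ) : ℂ) with hb
  have hb0 : 0 < b.re := by rw [hb, Complex.ofReal_re]; positivity
  set G : EuclideanSpace ℝ (Fin n) → ℂ := fun v =>
    Complex.exp (-b * ‖v‖ ^ 2 + 2 * Real.pi * Complex.I * (inner ℝ y v : ℝ)) with hG
  have hGi : Integrable G :=
    GaussianFourier.integrable_cexp_neg_mul_sq_norm_add hb0 (2 * Real.pi * Complex.I) y
  have e := VectorFourier.integral_fourierIntegral_smul_eq_flip (L := innerₗ (EuclideanSpace ℝ (Fin n)))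
    (μ := volume) (ν := volume) Real.continuous_fourierChar continuous_inner hGi φ.integrable
  have e1 : ∀ x, VectorFourier.fourierIntegral Real.fourierChar volume
      (innerₗ (EuclideanSpace ℝ (Fin n))) G x = heatKernel 4 t (y - x) := by
    intro x
    have := fourier_gaussian_innerProductSpace' hb0 y x
    refine Eq.trans this ?_
    rw [heatKernel, Complex.ofReal_mul, Complex.ofReal_exp, finrank_euclideanSpace_fin]
    congr 1
    · have h1 : (Real.pi : ℂ) / b = ((Real.pi / (4 * Real.pi ^ 2 * t) : ℝ) : ℂ) := by
        rw [hb]; push_cast; ring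
      have h2 : ((n : ℂ) / 2) = (((n : ℝ) / 2 : ℝ) : ℂ) := by push_cast; ring
      rw [h1, h2, ← Complex.ofReal_cpow (by positivity)]
      congr 1
      rw [Real.rpow_neg (by positivity), ← Real.inv_rpow (by positivity)]
      congr 1
      field_simp
    · congr 1
      rw [hb]
      push_cast
      have : (Real.pi : ℂ) ≠ 0 := by exact_mod_cast Real.pi_ne_zero
      have : (t : ℂ) ≠ 0 := by exact_mod_cast ht.ne'
      field_simp
  simp only [e1, smul_eq_mul] at e
  rw [e]
  refine integral_congr_ae (.of_forall fun ξ => ?_)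
  have e2 : VectorFourier.fourierIntegral Real.fourierChar volume
      (innerₗ (EuclideanSpace ℝ (Fin n))).flip φ ξ = 𝓕 φ ξ := by
    rw [SchwartzMap.fourier_coe, Real.fourier_eq]
    simp [VectorFourier.fourierIntegral, real_inner_comm]
  simp only [e2, hG]
  rw [← Complex.exp_add, add_comm]

-- On the Fourier side `1/(4π²|ξ|² - ev) = ∫ exp ((ev - 4π²|ξ|²) t) dt`, because `Re ev < 0`. Fubini
-- applies since `φ̂` is integrable and the exponential is dominated by `exp (t Re ev)`.
open FourierTransform in
theorem schwartzResolvent_apply {ev : ℂ} (hre : ev.re < 0) (φ : 𝓢(EuclideanSpace ℝ (Fin n), ℂ))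
    (y : EuclideanSpace ℝ (Fin n)) :
    schwartzResolvent ev φ y = ∫ t in Set.Ioi (0 : ℝ), Complex.exp (ev * t) *
      ∫ x, (heatKernel 4 t (y - x) : ℂ) * φ x := by
  have hm := hasTemperateGrowth_resolventSymbol (n := n) hre
  set e : EuclideanSpace ℝ (Fin n) → ℂ :=
    fun ξ => Complex.exp (2 * Real.pi * Complex.I * (inner ℝ y ξ : ℝ)) with he
  set c : EuclideanSpace ℝ (Fin n) → ℝ := fun ξ => (2 * Real.pi) ^ 2 * ‖ξ‖ ^ 2 with hc
  have e1 : schwartzResolvent ev φ y = ∫ ξ, e ξ * (∫ t in Set.Ioi (0 : ℝ),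
      Complex.exp ((ev - c ξ) * t)) * 𝓕 φ ξ := by
    rw [schwartzResolvent, SchwartzMap.fourierMultiplierCLM_apply, SchwartzMap.fourierInv_coe,
      Real.fourierInv_eq']
    refine integral_congr_ae (.of_forall fun ξ => ?_)
    have h1 : (ev - c ξ).re < 0 := by
      simp only [hc, Complex.sub_re, Complex.ofReal_re]
      have : 0 ≤ (2 * Real.pi) ^ 2 * ‖ξ‖ ^ 2 := by positivity
      linarith
    simp only
    rw [SchwartzMap.smulLeftCLM_apply_apply hm, integral_exp_mul_complex_Ioi h1,
      real_inner_comm, resolventSymbol]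
    simp only [he, smul_eq_mul, Complex.ofReal_zero, mul_zero, Complex.exp_zero]
    rw [← mul_assoc]
    congr 2
    · congr 1; push_cast; ring
    · rw [← neg_sub (ev), inv_neg, neg_div, one_div]
  have hint : Integrable (Function.uncurry fun (ξ : EuclideanSpace ℝ (Fin n)) (t : ℝ) =>
      e ξ * Complex.exp ((ev - c ξ) * t) * 𝓕 φ ξ)
      (volume.prod (volume.restrict (Set.Ioi (0 : ℝ)))) := by
    have h1 : Integrable (fun z : EuclideanSpace ℝ (Fin n) × ℝ =>
        ‖𝓕 φ z.1‖ * Real.exp (ev.re * z.2)) (volume.prod (volume.restrict (Set.Ioi (0 : ℝ)))) :=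
      (𝓕 φ).integrable.norm.mul_prod (integrableOn_exp_mul_Ioi hre 0)
    refine h1.mono' ?_ ?_
    · refine Continuous.aestronglyMeasurable ?_
      have := (𝓕 φ).continuous
      simp only [Function.uncurry_def, he, hc]
      fun_prop
    · rw [Measure.ae_prod_iff_ae_ae]
      · refine .of_forall fun ξ => ?_
        filter_upwards [ae_restrict_mem measurableSet_Ioi] with t ht
        rw [Set.mem_Ioi] at ht
        simp only [Function.uncurry, he, norm_mul, Complex.norm_exp]
        have h2 : (2 * Real.pi * Complex.I * (inner ℝ y ξ : ℝ) : ℂ).re = 0 := by simp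
        have h3 : ((ev - c ξ) * t : ℂ).re ≤ ev.re * t := by
          simp only [Complex.re_mul_ofReal, Complex.sub_re, Complex.ofReal_re]
          have : 0 ≤ c ξ := by simp only [hc]; positivity
          nlinarith
        rw [h2, Real.exp_zero, one_mul, mul_comm]
        gcongr
      · apply measurableSet_le
        · have := (𝓕 φ).continuous
          simp only [Function.uncurry_def, he, hc]
          refine Continuous.measurable ?_
          fun_prop
        · have := (𝓕 φ).continuous
          refine Continuous.measurable ?_
          fun_prop
  rw [e1]
  calc _ = ∫ ξ, ∫ t in Set.Ioi (0 : ℝ), e ξ * Complex.exp ((ev - c ξ) * t) * 𝓕 φ ξ := by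
        refine integral_congr_ae (.of_forall fun ξ => ?_)
        simp only
        rw [integral_mul_const, integral_const_mul]
    _ = ∫ t in Set.Ioi (0 : ℝ), ∫ ξ, e ξ * Complex.exp ((ev - c ξ) * t) * 𝓕 φ ξ :=
        integral_integral_swap hint
    _ = _ := by
        refine setIntegral_congr_fun measurableSet_Ioi fun t ht => ?_
        rw [← integral_fourier_heat ht, ← integral_const_mul]
        refine integral_congr_ae (.of_forall fun ξ => ?_)
        simp only [he, hc]
        have h1 : Complex.exp ((ev - ((2 * Real.pi) ^ 2 * ‖ξ‖ ^ 2 : ℝ)) * t) = Complex.exp (ev * t) *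
            Complex.exp (-((4 * Real.pi ^ 2 * t : ℝ) : ℂ) * ‖ξ‖ ^ 2) := by
          rw [← Complex.exp_add]
          congr 1
          push_cast
          ring
        rw [h1]
        ring

theorem heatKernel_nonneg (D : ℝ) {t : ℝ} (ht : 0 ≤ t) (x : EuclideanSpace ℝ (Fin n)) :
    0 ≤ heatKernel D t x := by
  unfold heatKernel
  positivity

theorem measurable_uncurry_heatKernel (D : ℝ) :
    Measurable fun z : EuclideanSpace ℝ (Fin n) × ℝ => heatKernel D z.2 z.1 := by
  unfold heatKernel
  fun_prop

/-- The convolution kernel of `(-Δ + κ)⁻¹` for `D = 4`, as an integral of heat kernels. -/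
def greenKernel (κ D : ℝ) (x : EuclideanSpace ℝ (Fin n)) : ℝ≥0∞ :=
  ∫⁻ t in Set.Ioi (0 : ℝ), ENNReal.ofReal (Real.exp (-(κ * t)) * heatKernel D t x)

theorem measurable_greenKernel (κ D : ℝ) :
    Measurable (greenKernel κ D : EuclideanSpace ℝ (Fin n) → ℝ≥0∞) := by
  refine Measurable.lintegral_prod_right' (f := fun z : EuclideanSpace ℝ (Fin n) × ℝ =>
    ENNReal.ofReal (Real.exp (-(κ * z.2)) * heatKernel D z.2 z.1)) ?_
  have := measurable_uncurry_heatKernel (n := n) D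
  fun_prop

theorem greenKernel_neg (κ D : ℝ) (x : EuclideanSpace ℝ (Fin n)) :
    greenKernel κ D (-x) = greenKernel κ D x := by
  simp [greenKernel, heatKernel]

/-- Absolute values are taken inside the heat representation. The heat kernel is nonnegative, so the
only loss is the phase of `exp (ev t)`. -/
theorem enorm_schwartzResolvent_le {ev : ℂ} (hre : ev.re < 0)
    (φ : 𝓢(EuclideanSpace ℝ (Fin n), ℂ)) (y : EuclideanSpace ℝ (Fin n)) :
    ‖schwartzResolvent ev φ y‖ₑ ≤ ∫⁻ x, greenKernel (-ev.re) 4 (y - x) * ‖φ x‖ₑ := by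
  have hmeas := measurable_uncurry_heatKernel (n := n) 4
  have hφ := φ.continuous.measurable
  rw [schwartzResolvent_apply hre]
  calc _ ≤ ∫⁻ t in Set.Ioi (0 : ℝ), ‖Complex.exp (ev * t) *
      ∫ x, (heatKernel 4 t (y - x) : ℂ) * φ x‖ₑ := enorm_integral_le_lintegral_enorm _
    _ ≤ ∫⁻ t in Set.Ioi (0 : ℝ), ∫⁻ x, ENNReal.ofReal (Real.exp (-(-ev.re * t)) *
        heatKernel 4 t (y - x)) * ‖φ x‖ₑ := by
      refine setLIntegral_mono' measurableSet_Ioi fun t ht => ?_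
      rw [← integral_const_mul]
      refine (enorm_integral_le_lintegral_enorm _).trans (lintegral_mono fun x => le_of_eq ?_)
      have h1 : ‖Complex.exp (ev * t)‖ₑ = ENNReal.ofReal (Real.exp (-(-ev.re * t))) := by
        rw [← ofReal_norm, Complex.norm_exp]
        simp
      have h2 : ‖(heatKernel 4 t (y - x) : ℂ)‖ₑ = ENNReal.ofReal (heatKernel 4 t (y - x)) := by
        rw [← ofReal_norm, Complex.norm_real, Real.norm_of_nonneg (heatKernel_nonneg _ (le_of_lt ht) _)]
      rw [enorm_mul, enorm_mul, h1, h2, ENNReal.ofReal_mul (Real.exp_pos _).le, mul_assoc]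
    _ = ∫⁻ x, ∫⁻ t in Set.Ioi (0 : ℝ), ENNReal.ofReal (Real.exp (-(-ev.re * t)) *
        heatKernel 4 t (y - x)) * ‖φ x‖ₑ := by
      refine lintegral_lintegral_swap (Measurable.aemeasurable ?_)
      have : Measurable fun z : ℝ × EuclideanSpace ℝ (Fin n) => heatKernel 4 z.1 (y - z.2) :=
        hmeas.comp ((measurable_const.sub measurable_snd).prodMk measurable_fst)
      simp only [Function.uncurry_def]
      fun_prop
    _ = _ := by
      refine lintegral_congr fun x => ?_
      rw [greenKernel, lintegral_mul_const]
      have : Measurable fun t : ℝ => heatKernel 4 t (y - x) :=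
        hmeas.comp (measurable_const.prodMk measurable_id)
      fun_prop

/-! ### The norm of the Green kernel -/

/-- Minkowski's integral inequality, for a family whose norms have a known bound. -/
theorem lintegral_rpow_lintegral_le {X T : Type*} [MeasurableSpace X] [MeasurableSpace T]
    {μ : Measure X} {ν : Measure T} [SFinite μ] [SFinite ν] {F : X → T → ℝ≥0∞} {c : T → ℝ≥0∞}
    (hF : Measurable (Function.uncurry F)) (hc : Measurable c) {β : ℝ} (hβ : 1 ≤ β)
    (hc0 : ∀ᵐ t ∂ν, c t ≠ 0) (hct : ∀ᵐ t ∂ν, c t ≠ ∞)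
    (h : ∀ᵐ t ∂ν, ∫⁻ x, F x t ^ β ∂μ ≤ c t ^ β) :
    ∫⁻ x, (∫⁻ t, F x t ∂ν) ^ β ∂μ ≤ (∫⁻ t, c t ∂ν) ^ β := by
  have hβ0 : 0 < β := by linarith
  have hFx : ∀ x, Measurable (F x) := fun x => hF.comp measurable_prodMk_left
  -- Hölder for `F = c^(1 - 1/β) · (c^(1-β) F^β)^(1/β)`, that is, Jensen's inequality for `F/c`
  -- against the measure `c dν`. Integrating in `x` then turns `c^(1-β) F^β` into at most `c`.
  have e1 : ∀ x, (∫⁻ t, F x t ∂ν) ^ β ≤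
      (∫⁻ t, c t ∂ν) ^ (β - 1) * ∫⁻ t, c t ^ (1 - β) * F x t ^ β ∂ν := by
    intro x
    have h1 : ∫⁻ t, F x t ∂ν = ∫⁻ t, c t ^ (1 - β⁻¹) * (c t ^ (1 - β) * F x t ^ β) ^ β⁻¹ ∂ν := by
      refine lintegral_congr_ae ?_
      filter_upwards [hc0, hct] with t h0 h1
      rw [ENNReal.mul_rpow_of_nonneg _ _ (by positivity), ENNReal.rpow_rpow_inv hβ0.ne',
        ← ENNReal.rpow_mul, ← mul_assoc, ← ENNReal.rpow_add _ _ h0 h1]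
      have : 1 - β⁻¹ + (1 - β) * β⁻¹ = 0 := by field_simp; ring
      rw [this, ENNReal.rpow_zero, one_mul]
    have h2 := ENNReal.lintegral_mul_norm_pow_le (μ := ν) (f := c)
      (g := fun t => c t ^ (1 - β) * F x t ^ β) hc.aemeasurable
      ((hc.pow_const _).mul ((hFx x).pow_const _)).aemeasurable
      (p := 1 - β⁻¹) (q := β⁻¹) (by have := inv_le_one_of_one_le₀ hβ; linarith) (by positivity)
      (by ring)
    rw [← h1] at h2
    refine (ENNReal.rpow_le_rpow h2 hβ0.le).trans (le_of_eq ?_)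
    rw [ENNReal.mul_rpow_of_nonneg _ _ hβ0.le, ENNReal.rpow_inv_rpow hβ0.ne', ← ENNReal.rpow_mul]
    congr 2
    field_simp
  calc _ ≤ ∫⁻ x, (∫⁻ t, c t ∂ν) ^ (β - 1) * ∫⁻ t, c t ^ (1 - β) * F x t ^ β ∂ν ∂μ :=
        lintegral_mono e1
    _ = (∫⁻ t, c t ∂ν) ^ (β - 1) * ∫⁻ t, ∫⁻ x, c t ^ (1 - β) * F x t ^ β ∂μ ∂ν := by
        have hm : Measurable (Function.uncurry fun x t => c t ^ (1 - β) * F x t ^ β) :=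
          ((hc.pow_const _).comp measurable_snd).mul (hF.pow_const _)
        rw [lintegral_const_mul _ hm.lintegral_prod_right, lintegral_lintegral_swap hm.aemeasurable]
    _ ≤ (∫⁻ t, c t ∂ν) ^ (β - 1) * ∫⁻ t, c t ∂ν := by
        refine mul_le_mul' le_rfl (lintegral_mono_ae ?_)
        filter_upwards [hc0, hct, h] with t h0 h1 h2
        have hFt : Measurable fun x => F x t := hF.comp measurable_prodMk_right
        rw [lintegral_const_mul _ (hFt.pow_const _)]
        calc _ ≤ c t ^ (1 - β) * c t ^ β := by gcongr
          _ = c t := by rw [← ENNReal.rpow_add _ _ h0 h1]; simp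
    _ = _ := by
        nth_rw 2 [← ENNReal.rpow_one (∫⁻ t, c t ∂ν)]
        rw [← ENNReal.rpow_add_of_nonneg _ _ (by linarith) zero_le_one]
        simp

theorem lintegral_heatKernel_rpow {D t β : ℝ} (hD : 0 < D) (ht : 0 < t) (hβ : 0 < β) :
    ∫⁻ x : EuclideanSpace ℝ (Fin n), ENNReal.ofReal (heatKernel D t x) ^ β =
      ENNReal.ofReal ((4 * Real.pi * t) ^ (-((n : ℝ) / 2)) *
        (Real.pi * D * t / β) ^ ((n : ℝ) / (2 * β))) ^ β := by
  have hb : 0 < β / (D * t) := by positivity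
  have e1 : ∀ x : EuclideanSpace ℝ (Fin n), ENNReal.ofReal (heatKernel D t x) ^ β =
      ENNReal.ofReal (((4 * Real.pi * t) ^ (-((n : ℝ) / 2))) ^ β) *
        ENNReal.ofReal (Real.exp (-(β / (D * t)) * ‖x‖ ^ 2)) := by
    intro x
    rw [ENNReal.ofReal_rpow_of_nonneg (heatKernel_nonneg _ ht.le _) hβ.le, heatKernel,
      Real.mul_rpow (by positivity) (by positivity), ENNReal.ofReal_mul (by positivity),
      ← Real.exp_mul]
    congr 3
    field_simp
  have hi : Integrable fun x : EuclideanSpace ℝ (Fin n) => Real.exp (-(β / (D * t)) * ‖x‖ ^ 2) := by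
    have h1 := GaussianFourier.integral_rexp_neg_mul_sq_norm (V := EuclideanSpace ℝ (Fin n)) hb
    refine Integrable.of_integral_ne_zero ?_
    rw [h1]
    positivity
  simp_rw [e1]
  rw [lintegral_const_mul _ (by fun_prop), ← ofReal_integral_eq_lintegral_ofReal hi
    (.of_forall fun x => (Real.exp_pos _).le), GaussianFourier.integral_rexp_neg_mul_sq_norm hb,
    finrank_euclideanSpace_fin, ENNReal.ofReal_rpow_of_nonneg (by positivity) hβ.le,
    Real.mul_rpow (x := (4 * Real.pi * t) ^ (-((n : ℝ) / 2))) (by positivity) (by positivity),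
    ← Real.rpow_mul (x := Real.pi * D * t / β) (by positivity) _ β, ENNReal.ofReal_mul (by positivity)]
  congr 3
  · field_simp
  · field_simp

/-- The bound for the `L_β` norm of `greenKernel κ D`. -/
def greenBound (n : ℕ) (κ D β : ℝ) : ℝ :=
  (4 * Real.pi) ^ (-((n : ℝ) / 2)) * (Real.pi * D / β) ^ ((n : ℝ) / (2 * β)) *
    Real.Gamma (1 - n / 2 * (1 - 1 / β)) * (1 / κ) ^ (1 - n / 2 * (1 - 1 / β))

/-- Minkowski's inequality, with `c t` the exact `L_β` norm of the integrand. It is a constant times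
`t^(-(n/2)(1 - 1/β)) exp (-κ t)`, hence a Gamma integral, and `hβn` is its convergence at `t = 0`.
-/
theorem lintegral_greenKernel_rpow_le {κ D β : ℝ} (hκ : 0 < κ) (hD : 0 < D) (hβ : 1 ≤ β)
    (hβn : n / 2 * (1 - 1 / β) < 1) :
    ∫⁻ x : EuclideanSpace ℝ (Fin n), greenKernel κ D x ^ β ≤
      ENNReal.ofReal (greenBound n κ D β) ^ β := by
  have hβ0 : 0 < β := by linarith
  set c : ℝ → ℝ := fun t => Real.exp (-(κ * t)) * ((4 * Real.pi * t) ^ (-((n : ℝ) / 2)) *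
        (Real.pi * D * t / β) ^ ((n : ℝ) / (2 * β))) with hc
  have hcpos : ∀ t, 0 < t → 0 < c t := fun t ht => by simp only [hc]; positivity
  have hmeas := measurable_uncurry_heatKernel (n := n) D
  have h1 := lintegral_rpow_lintegral_le (μ := (volume : Measure (EuclideanSpace ℝ (Fin n))))
    (ν := volume.restrict (Set.Ioi (0 : ℝ))) (c := fun t => ENNReal.ofReal (c t))
    (F := fun x t => ENNReal.ofReal (Real.exp (-(κ * t)) * heatKernel D t x))
    (by simp only [Function.uncurry_def]; fun_prop) (by simp only [hc]; fun_prop) hβ ?_ ?_ ?_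
  · refine h1.trans (le_of_eq ?_)
    congr 1
    have hint : ∫ t in Set.Ioi (0 : ℝ), c t = greenBound n κ D β := by
      have h2 := Real.integral_rpow_mul_exp_neg_mul_Ioi
        (a := 1 - n / 2 * (1 - 1 / β)) (by linarith) hκ
      rw [greenBound, mul_assoc _ (Real.Gamma _), mul_comm (Real.Gamma _), ← h2, ← integral_const_mul]
      refine setIntegral_congr_fun measurableSet_Ioi fun t ht => ?_
      have ht' : (0 : ℝ) < t := ht
      simp only [hc]
      rw [mul_div_right_comm (Real.pi * D) t β, Real.mul_rpow (by positivity) ht'.le,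
        Real.mul_rpow (by positivity) ht'.le]
      have : (1 - (n : ℝ) / 2 * (1 - 1 / β) - 1) = -((n : ℝ) / 2) + n / (2 * β) := by
        field_simp
        ring
      rw [this, Real.rpow_add ht']
      ring
    rw [← hint, ofReal_integral_eq_lintegral_ofReal]
    · refine Integrable.of_integral_ne_zero ?_
      rw [hint, greenBound]
      have := Real.Gamma_pos_of_pos (s := 1 - n / 2 * (1 - 1 / β)) (by linarith)
      positivity
    · filter_upwards [ae_restrict_mem measurableSet_Ioi] with t ht using (hcpos t ht).le
  · filter_upwards [ae_restrict_mem measurableSet_Ioi] with t ht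
    simpa using hcpos t ht
  · exact .of_forall fun t => ENNReal.ofReal_ne_top
  · filter_upwards [ae_restrict_mem measurableSet_Ioi] with t ht
    have ht' : (0 : ℝ) < t := ht
    have hm : Measurable fun x : EuclideanSpace ℝ (Fin n) => heatKernel D t x :=
      hmeas.comp (measurable_id.prodMk measurable_const)
    simp only [hc]
    rw [ENNReal.ofReal_mul (Real.exp_pos _).le, ENNReal.mul_rpow_of_nonneg _ _ hβ0.le,
      ← lintegral_heatKernel_rpow hD ht' hβ0, ← lintegral_const_mul _ (by fun_prop)]
    refine le_of_eq (lintegral_congr fun x => ?_)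
    rw [ENNReal.ofReal_mul (Real.exp_pos _).le, ENNReal.mul_rpow_of_nonneg _ _ hβ0.le]

/-- Only for `D = 4`, the true heat kernel, is the explicit value needed; the kernel with `D = 8`
enters through finiteness alone. -/
theorem greenBound_four {κ β : ℝ} (hκ : 0 < κ) (hβ : 0 < β) :
    greenBound n κ 4 β = (4 * Real.pi) ^ (-(n / 2 * (1 - 1 / β))) * β ^ (-(n / (2 * β))) *
        Real.Gamma (1 - n / 2 * (1 - 1 / β)) / κ ^ (1 - n / 2 * (1 - 1 / β)) := by
  have e1 : -(n / 2 * (1 - 1 / β)) = -((n : ℝ) / 2) + n / (2 * β) := by field_simp; ring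
  rw [greenBound, Real.div_rpow zero_le_one hκ.le, Real.one_rpow, e1, Real.rpow_add (by positivity),
    Real.rpow_neg hβ.le, Real.div_rpow (by positivity) hβ.le, mul_comm Real.pi 4]
  ring

/-! ### A polynomial weight and the decay of the Green kernel -/

/-- A slowly decaying integrable weight. -/
def weight (x : EuclideanSpace ℝ (Fin n)) : ℝ≥0∞ :=
  ENNReal.ofReal ((1 + ‖x‖) ^ (-((n : ℝ) + 1)))

theorem measurable_weight : Measurable (weight : EuclideanSpace ℝ (Fin n) → ℝ≥0∞) := by
  unfold weight
  fun_prop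

theorem weight_ne_zero (x : EuclideanSpace ℝ (Fin n)) : weight x ≠ 0 := by
  unfold weight
  simp only [ne_eq, ENNReal.ofReal_eq_zero, not_le]
  positivity

theorem weight_le_one (x : EuclideanSpace ℝ (Fin n)) : weight x ≤ 1 := by
  unfold weight
  rw [ENNReal.ofReal_le_one]
  exact Real.rpow_le_one_of_one_le_of_nonpos (by linarith [norm_nonneg x])
    (by have : (0 : ℝ) ≤ n := Nat.cast_nonneg n
        linarith)

theorem weight_neg (x : EuclideanSpace ℝ (Fin n)) : weight (-x) = weight x := by
  simp [weight]

theorem lintegral_weight_lt_top : ∫⁻ x : EuclideanSpace ℝ (Fin n), weight x < ∞ := by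
  have := integrable_one_add_norm (E := EuclideanSpace ℝ (Fin n)) (μ := volume)
    (r := (n : ℝ) + 1) (by simp)
  have h := this.lintegral_lt_top
  exact h

/-- The weight is submultiplicative in the strong sense. -/
theorem weight_sub_mul_weight_le (x y : EuclideanSpace ℝ (Fin n)) :
    weight (x - y) * weight x ≤ weight y := by
  unfold weight
  rw [← ENNReal.ofReal_mul (by positivity), ← Real.mul_rpow (by positivity) (by positivity)]
  refine ENNReal.ofReal_le_ofReal (Real.rpow_le_rpow_of_nonpos (by positivity) ?_
    (by have : (0 : ℝ) ≤ n := Nat.cast_nonneg n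
        linarith))
  have : ‖y‖ ≤ ‖x - y‖ + ‖x‖ := by
    rw [norm_sub_rev]
    calc ‖y‖ = ‖(y - x) + x‖ := by simp
      _ ≤ _ := norm_add_le _ _
  nlinarith [norm_nonneg x, norm_nonneg (x - y), mul_nonneg (norm_nonneg (x - y)) (norm_nonneg x)]

theorem weight_sub_le {x y z : EuclideanSpace ℝ (Fin n)} (h : dist z y < 1) :
    weight (x - y) ≤ 2 ^ ((n : ℝ) + 1) * weight (x - z) := by
  have h2 : (2 : ℝ≥0∞) ^ ((n : ℝ) + 1) = ENNReal.ofReal ((2 : ℝ) ^ ((n : ℝ) + 1)) := by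
    rw [← ENNReal.ofReal_rpow_of_pos two_pos]
    simp
  unfold weight
  rw [h2, ← ENNReal.ofReal_mul (by positivity)]
  refine ENNReal.ofReal_le_ofReal ?_
  rw [Real.rpow_neg (by positivity), Real.rpow_neg (by positivity), ← div_eq_mul_inv,
    ← Real.div_rpow (by positivity) (by positivity), ← Real.inv_rpow (by positivity)]
  refine Real.rpow_le_rpow (by positivity) ?_ (by positivity)
  rw [inv_eq_one_div, div_le_div_iff₀ (by positivity) (by positivity)]
  have : ‖x - z‖ ≤ ‖x - y‖ + 1 := by
    calc ‖x - z‖ = ‖(x - y) + (y - z)‖ := by congr 1; abel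
      _ ≤ ‖x - y‖ + ‖y - z‖ := norm_add_le _ _
      _ ≤ _ := by
        rw [dist_eq_norm, norm_sub_rev] at h
        linarith
  nlinarith [norm_nonneg (x - y)]

/-- The exponent `κ t + ‖x‖²/(4t)` is split into two equal halves. By the arithmetic-geometric mean
inequality one half is at least `√κ ‖x‖ / 2`, which beats any polynomial. The other half is the
exponent of the kernel with parameters `κ/2` and `8`. -/
theorem exists_greenKernel_le_weight {κ : ℝ} (hκ : 0 < κ) :
    ∃ C : ℝ≥0∞, C ≠ ∞ ∧ ∀ x : EuclideanSpace ℝ (Fin n),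
      greenKernel κ 4 x ≤ C * weight x * greenKernel (κ / 2) 8 x := by
  set d := √κ / 2 with hd
  have hd0 : 0 < d := by have := Real.sqrt_pos.2 hκ; positivity
  -- The constant comes from `s^(n+1) / (n+1)! ≤ exp s` at `s = d (1 + u)`.
  set C : ℝ := (n + 1).factorial * (1 / d) ^ (n + 1) * Real.exp d with hC
  have hC0 : 0 ≤ C := by positivity
  have key : ∀ u : ℝ, 0 ≤ u → Real.exp (-(d * u)) ≤ C * (1 + u) ^ (-((n : ℝ) + 1)) := by
    intro u hu
    have h1 := Real.pow_div_factorial_le_exp (d * (1 + u)) (by positivity) (n + 1)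
    have h2 : (1 + u) ^ (-((n : ℝ) + 1)) = ((1 + u) ^ (n + 1))⁻¹ := by
      rw [Real.rpow_neg (by positivity), ← Real.rpow_natCast]
      push_cast
      rfl
    rw [h2, ← div_eq_mul_inv, le_div_iff₀ (by positivity), Real.exp_neg, ← div_eq_inv_mul,
      div_le_iff₀ (Real.exp_pos _), hC]
    rw [div_le_iff₀ (by positivity), mul_pow, mul_add, Real.exp_add, mul_one] at h1
    calc (1 + u) ^ (n + 1) = (1 / d) ^ (n + 1) * (d ^ (n + 1) * (1 + u) ^ (n + 1)) := by
          rw [← mul_assoc, ← mul_pow, one_div_mul_cancel hd0.ne', one_pow, one_mul]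
      _ ≤ (1 / d) ^ (n + 1) * (Real.exp d * Real.exp (d * u) * (n + 1).factorial) := by gcongr
      _ = _ := by ring
  refine ⟨ENNReal.ofReal C, ENNReal.ofReal_ne_top, fun x => ?_⟩
  have hmeas : Measurable fun t : ℝ => heatKernel 8 t x :=
    (measurable_uncurry_heatKernel (n := n) 8).comp (measurable_const.prodMk measurable_id)
  rw [greenKernel, greenKernel, weight, ← ENNReal.ofReal_mul hC0,
    ← lintegral_const_mul _ (by fun_prop)]
  refine setLIntegral_mono' measurableSet_Ioi fun t ht => ?_
  have ht' : (0 : ℝ) < t := ht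
  rw [← ENNReal.ofReal_mul (by positivity)]
  refine ENNReal.ofReal_le_ofReal ?_
  have h1 := key ‖x‖ (norm_nonneg x)
  have h2 : d * ‖x‖ ≤ κ * t / 2 + ‖x‖ ^ 2 / (8 * t) := by
    have : 0 ≤ (√κ * t * 2 - ‖x‖) ^ 2 / (8 * t) := by positivity
    have e : (√κ * t * 2 - ‖x‖) ^ 2 / (8 * t) =
        κ * t / 2 + ‖x‖ ^ 2 / (8 * t) - d * ‖x‖ := by
      rw [hd]
      field_simp
      ring_nf
      rw [Real.sq_sqrt hκ.le]
      ring
    linarith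
  have h3 : Real.exp (-(κ * t)) * Real.exp (-(‖x‖ ^ 2 / (4 * t))) ≤
      Real.exp (-(d * ‖x‖)) * (Real.exp (-(κ / 2 * t)) * Real.exp (-(‖x‖ ^ 2 / (8 * t)))) := by
    rw [← Real.exp_add, ← Real.exp_add, ← Real.exp_add, Real.exp_le_exp]
    have : ‖x‖ ^ 2 / (4 * t) = 2 * (‖x‖ ^ 2 / (8 * t)) := by field_simp; ring
    rw [this]
    linarith
  unfold heatKernel
  calc Real.exp (-(κ * t)) * ((4 * Real.pi * t) ^ (-((n : ℝ) / 2)) *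
        Real.exp (-(‖x‖ ^ 2 / (4 * t))))
      = (4 * Real.pi * t) ^ (-((n : ℝ) / 2)) *
        (Real.exp (-(κ * t)) * Real.exp (-(‖x‖ ^ 2 / (4 * t)))) := by ring
    _ ≤ (4 * Real.pi * t) ^ (-((n : ℝ) / 2)) * (C * (1 + ‖x‖) ^ (-((n : ℝ) + 1)) *
        (Real.exp (-(κ / 2 * t)) * Real.exp (-(‖x‖ ^ 2 / (8 * t))))) := by
        refine mul_le_mul_of_nonneg_left (h3.trans ?_) (by positivity)
        gcongr
    _ = _ := by ring

-- Young's convolution inequality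

local notation "𝔼" => EuclideanSpace ℝ (Fin n)

theorem aemeasurable_sub_mul {k h : 𝔼 → ℝ≥0∞} (hk : Measurable k) (hh : AEMeasurable h) (x : 𝔼) :
    AEMeasurable fun y => k (x - y) * h y :=
  (hk.comp (measurable_const.sub measurable_id)).aemeasurable.mul hh

theorem aemeasurable_prod_sub_mul {k h : 𝔼 → ℝ≥0∞} (hk : Measurable k) (hh : AEMeasurable h) :
    AEMeasurable (fun z : 𝔼 × 𝔼 => k (z.1 - z.2) * h z.2) (volume.prod volume) :=
  (hk.comp (measurable_fst.sub measurable_snd)).aemeasurable.mul hh.comp_snd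

theorem lintegral_sub_left_eq (k : 𝔼 → ℝ≥0∞) (x : 𝔼) : ∫⁻ y, k (x - y) = ∫⁻ y, k y :=
  lintegral_sub_left_eq_self k x

/-- The pointwise estimate behind Young's convolution inequality. -/
theorem lintegral_sub_mul_le {k h : 𝔼 → ℝ≥0∞} (hk : Measurable k) (hh : AEMeasurable h)
    {A S : ℝ} (hA : 0 < A) (hA1 : A ≤ 1) (hS : 0 < S) (hS1 : S ≤ 1) (hT : 0 ≤ A + S - 1) (x : 𝔼) :
    ∫⁻ y, k (x - y) * h y ≤ (∫⁻ y, k (x - y) ^ A⁻¹ * h y ^ S⁻¹) ^ (A + S - 1) *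
      (∫⁻ y, k y ^ A⁻¹) ^ (1 - S) * (∫⁻ y, h y ^ S⁻¹) ^ (1 - A) := by
  have hkx : Measurable fun y => k (x - y) := hk.comp (measurable_const.sub measurable_id)
  -- Hölder with three factors. `A` and `S` are the reciprocals of the exponents of `k` and `h`, and
  -- the Hölder weights `A + S - 1`, `1 - S`, `1 - A` add up to one.
  have h1 := ENNReal.lintegral_prod_norm_pow_le (μ := (volume : Measure 𝔼)) Finset.univ
    (f := ![fun y => k (x - y) ^ A⁻¹ * h y ^ S⁻¹, fun y => k (x - y) ^ A⁻¹, fun y => h y ^ S⁻¹])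
    (p := ![A + S - 1, 1 - S, 1 - A]) (fun i _ => ?_) ?_ (fun i _ => ?_)
  · simp only [Fin.prod_univ_three, Matrix.cons_val_zero, Matrix.cons_val_one,
      Matrix.cons_val] at h1
    rw [lintegral_sub_left_eq (fun y => k y ^ A⁻¹)] at h1
    refine le_trans (le_of_eq (lintegral_congr fun y => ?_)) h1
    rw [ENNReal.mul_rpow_of_nonneg _ _ hT, ← ENNReal.rpow_mul, ← ENNReal.rpow_mul,
      ← ENNReal.rpow_mul, ← ENNReal.rpow_mul]
    rw [mul_right_comm _ _ (k (x - y) ^ (A⁻¹ * (1 - S))), mul_assoc,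
      ← ENNReal.rpow_add_of_nonneg _ _ (by positivity) (mul_nonneg (by positivity) (by linarith)),
      ← ENNReal.rpow_add_of_nonneg _ _ (by positivity) (mul_nonneg (by positivity) (by linarith))]
    have e1 : A⁻¹ * (A + S - 1) + A⁻¹ * (1 - S) = 1 := by field_simp; ring
    have e2 : S⁻¹ * (A + S - 1) + S⁻¹ * (1 - A) = 1 := by field_simp; ring
    rw [e1, e2, ENNReal.rpow_one, ENNReal.rpow_one]
  · fin_cases i
    · exact ((hkx.pow_const _).aemeasurable.mul (hh.pow_const _))
    · exact (hkx.pow_const _).aemeasurable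
    · exact hh.pow_const _
  · simp [Fin.sum_univ_three]
  · fin_cases i
    · exact hT
    · simpa using hS1
    · simpa using hA1

/-- Young's convolution inequality, with finite exponents. -/
theorem lintegral_conv_rpow_le {k h : 𝔼 → ℝ≥0∞} (hk : Measurable k) (hh : AEMeasurable h)
    {A S T : ℝ} (hA : 0 < A) (hA1 : A ≤ 1) (hS : 0 < S) (hS1 : S ≤ 1) (hT : 0 < T)
    (hAST : T = A + S - 1) :
    ∫⁻ x, (∫⁻ y, k (x - y) * h y) ^ T⁻¹ ≤
      ((∫⁻ y, k y ^ A⁻¹) ^ A * (∫⁻ y, h y ^ S⁻¹) ^ S) ^ T⁻¹ := by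
  subst hAST
  set T := A + S - 1 with hTdef
  set X := ∫⁻ y, k y ^ A⁻¹
  set Y := ∫⁻ y, h y ^ S⁻¹
  have h1 : ∀ x, (∫⁻ y, k (x - y) * h y) ^ T⁻¹ ≤
      (∫⁻ y, k (x - y) ^ A⁻¹ * h y ^ S⁻¹) * (X ^ ((1 - S) * T⁻¹) * Y ^ ((1 - A) * T⁻¹)) := by
    intro x
    refine (ENNReal.rpow_le_rpow (lintegral_sub_mul_le hk hh hA hA1 hS hS1 hT.le x)
      (by positivity)).trans (le_of_eq ?_)
    rw [ENNReal.mul_rpow_of_nonneg _ _ (by positivity), ENNReal.mul_rpow_of_nonneg _ _ (by positivity),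
      ENNReal.rpow_rpow_inv hT.ne', ← ENNReal.rpow_mul, ← ENNReal.rpow_mul, mul_assoc]
  have h2 := aemeasurable_prod_sub_mul (hk.pow_const A⁻¹) (hh.pow_const S⁻¹)
  calc _ ≤ ∫⁻ x, (∫⁻ y, k (x - y) ^ A⁻¹ * h y ^ S⁻¹) *
        (X ^ ((1 - S) * T⁻¹) * Y ^ ((1 - A) * T⁻¹)) := lintegral_mono h1
    _ = (∫⁻ x, ∫⁻ y, k (x - y) ^ A⁻¹ * h y ^ S⁻¹) *
        (X ^ ((1 - S) * T⁻¹) * Y ^ ((1 - A) * T⁻¹)) := by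
        rw [lintegral_mul_const'' _ h2.lintegral_prod_right']
    _ = (X * Y) * (X ^ ((1 - S) * T⁻¹) * Y ^ ((1 - A) * T⁻¹)) := by
        rw [lintegral_lintegral_swap h2]
        congr 1
        have h3 : ∀ y, ∫⁻ x, k (x - y) ^ A⁻¹ * h y ^ S⁻¹ = X * h y ^ S⁻¹ := fun y => by
          have hm : Measurable fun x => k (x - y) ^ A⁻¹ :=
            (hk.comp (measurable_id.sub measurable_const)).pow_const _
          rw [lintegral_mul_const _ hm]
          congr 1
          exact lintegral_sub_right_eq_self (fun z => k z ^ A⁻¹) y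
        simp_rw [h3]
        rw [lintegral_const_mul'' _ (hh.pow_const _)]
    _ = _ := by
        rw [ENNReal.mul_rpow_of_nonneg _ _ (by positivity), ← ENNReal.rpow_mul, ← ENNReal.rpow_mul,
          mul_mul_mul_comm]
        nth_rw 1 [← ENNReal.rpow_one X]
        nth_rw 1 [← ENNReal.rpow_one Y]
        rw [← ENNReal.rpow_add_of_nonneg _ _ zero_le_one
            (mul_nonneg (by linarith) (by positivity)),
          ← ENNReal.rpow_add_of_nonneg _ _ zero_le_one (mul_nonneg (by linarith) (by positivity))]
        congr 2
        · field_simp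
          linarith
        · field_simp
          linarith

/-- Young's convolution inequality. -/
theorem eLpNorm_conv_le {k h : 𝔼 → ℝ≥0∞} (hk : Measurable k) (hh : AEMeasurable h)
    {A : ℝ} (hA : 0 < A) (hA1 : A ≤ 1) {σ τ : ℝ≥0∞} (hσ : 1 ≤ σ) (hσt : σ ≠ ∞)
    (hτ : τ⁻¹.toReal = A + σ⁻¹.toReal - 1) (hτ0 : τ ≠ 0) :
    eLpNorm (fun x => ∫⁻ y, k (x - y) * h y) τ volume ≤
      (∫⁻ y, k y ^ A⁻¹) ^ A * eLpNorm h σ volume := by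
  have hσ0 : σ ≠ 0 := (one_pos.trans_le hσ).ne'
  have hσr : 1 ≤ σ.toReal := by simpa using ENNReal.toReal_mono hσt hσ
  have hS : 0 < σ.toReal⁻¹ := by positivity
  have hS1 : σ.toReal⁻¹ ≤ 1 := inv_le_one_of_one_le₀ hσr
  rw [ENNReal.toReal_inv, ENNReal.toReal_inv] at hτ
  have hTnn : 0 ≤ A + σ.toReal⁻¹ - 1 := by rw [← hτ]; positivity
  have eh : eLpNorm h σ volume = (∫⁻ y, h y ^ σ.toReal⁻¹⁻¹) ^ σ.toReal⁻¹ := by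
    rw [eLpNorm_eq_lintegral_rpow_enorm_toReal hσ0 hσt, one_div, inv_inv]
    simp
  rw [eh]
  -- For `τ = ∞` one has `A + S = 1`, so the first factor of the pointwise estimate is trivial and
  -- that estimate is already the supremum bound.
  by_cases hτt : τ = ∞
  · subst hτt
    rw [ENNReal.toReal_top, inv_zero] at hτ
    rw [eLpNorm_exponent_top]
    refine essSup_le_of_ae_le _ (.of_forall fun x => ?_)
    have := lintegral_sub_mul_le hk hh hA hA1 hS hS1 hTnn x
    rw [← hτ, ENNReal.rpow_zero, one_mul] at this
    refine (enorm_eq_self _).trans_le ?_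
    refine this.trans (le_of_eq ?_)
    congr 2 <;> linarith
  · have hτr : 0 < τ.toReal := ENNReal.toReal_pos hτ0 hτt
    have := lintegral_conv_rpow_le hk hh hA hA1 hS hS1 (T := τ.toReal⁻¹) (by positivity) hτ
    rw [eLpNorm_eq_lintegral_rpow_enorm_toReal hτ0 hτt, one_div]
    simp only [enorm_eq_self]
    rw [inv_inv] at this
    refine (ENNReal.rpow_le_rpow this (by positivity)).trans (le_of_eq ?_)
    rw [ENNReal.rpow_rpow_inv hτr.ne']

/-! ### Uniform local bounds from the Stummel condition -/

/-- Functions with finite Stummel quantity have uniformly bounded weighted local norms. -/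
theorem exists_lintegral_weight_mul_le (hn : 3 ≤ n) {a : 𝔼 → ℂ} (ha : AEStronglyMeasurable a volume)
    {ν t : ℝ} (hM : stummel ν t a < ∞) :
    ∃ M : ℝ≥0∞, M ≠ ∞ ∧ ∀ x, ∫⁻ y, weight (x - y) * ‖a y‖ₑ ^ t ≤ M := by
  have : Nonempty (Fin n) := ⟨⟨0, by omega⟩⟩
  set e : ℝ := ν - n with he
  set c := ∫⁻ z in Metric.ball (0 : 𝔼) 1, edist z 0 ^ e with hc
  have hmeas : Measurable fun z : 𝔼 => edist z 0 ^ e := by fun_prop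
  -- Only `c ≠ 0` is needed to divide by `c`; if `c = ∞`, the bound below is zero by the conventions
  -- of `ℝ≥0∞`.
  have hc0 : c ≠ 0 := by
    intro h0
    rw [hc, lintegral_eq_zero_iff hmeas, Filter.EventuallyEq,
      ae_restrict_iff' measurableSet_ball] at h0
    have h1 : ∀ᵐ z : 𝔼, z ∉ Metric.ball (0 : 𝔼) 1 := by
      filter_upwards [h0, Measure.ae_ne volume (0 : 𝔼)] with z hz hz0 hz1
      have := hz hz1
      simp only [Pi.zero_apply, ENNReal.rpow_eq_zero_iff] at this
      rcases this with h | h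
      · exact hz0 (edist_eq_zero.1 h.1)
      · exact edist_ne_top _ _ h.1
    have h2 : volume (Metric.ball (0 : 𝔼) 1) = 0 := measure_eq_zero_iff_ae_notMem.2 h1
    exact (Metric.measure_ball_pos volume (0 : 𝔼) one_pos).ne' h2
  set W : 𝔼 → ℝ≥0∞ := (Metric.ball (0 : 𝔼) 1).indicator fun z => edist z 0 ^ e with hW
  have hWm : Measurable W := hmeas.indicator measurableSet_ball
  have hWint : ∫⁻ z, W z = c := by rw [hW, lintegral_indicator measurableSet_ball]
  have ham : AEMeasurable fun y => ‖a y‖ₑ ^ t := ha.enorm.pow_const t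
  have hst : ∀ z, ∫⁻ y, W (z - y) * ‖a y‖ₑ ^ t ≤ stummel ν t a := by
    intro z
    refine le_trans (le_of_eq ?_) (le_iSup (fun x : 𝔼 =>
      ∫⁻ y in Metric.ball x 1, ‖a y‖ₑ ^ t * edist x y ^ (ν - (n : ℝ))) z)
    rw [← lintegral_indicator measurableSet_ball]
    refine lintegral_congr fun y => ?_
    by_cases hy : y ∈ Metric.ball z 1
    · have hy' : z - y ∈ Metric.ball (0 : 𝔼) 1 := by
        rw [Metric.mem_ball, dist_comm, dist_eq_norm] at hy
        simpa using hy
      rw [hW, Set.indicator_of_mem hy', Set.indicator_of_mem hy, mul_comm, edist_zero_right,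
        edist_eq_enorm_sub]
    · have hy' : z - y ∉ Metric.ball (0 : 𝔼) 1 := by
        rw [Metric.mem_ball, dist_comm, dist_eq_norm] at hy
        simpa using hy
      rw [hW, Set.indicator_of_notMem hy', Set.indicator_of_notMem hy, zero_mul]
  set J := ∫⁻ x : 𝔼, weight x
  refine ⟨2 ^ ((n : ℝ) + 1) * J * stummel ν t a / c, ?_, fun x => ?_⟩
  · refine (ENNReal.div_lt_top ?_ hc0).ne
    refine ENNReal.mul_ne_top (ENNReal.mul_ne_top ?_ lintegral_weight_lt_top.ne) hM.ne
    exact ENNReal.rpow_ne_top_of_nonneg (by positivity) (by simp)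
  -- The weight is comparable to its average over the unit ball around `y` against the singular
  -- kernel `W`. After Tonelli, the integral in `y` is a Stummel integral centred at `z`.
  have h1 : ∀ y, c * weight (x - y) ≤ 2 ^ ((n : ℝ) + 1) * ∫⁻ z, weight (x - z) * W (z - y) := by
    intro y
    have h2 : ∫⁻ z, W (z - y) = c := (lintegral_sub_right_eq_self W y).trans hWint
    have hm1 : Measurable fun z => W (z - y) := hWm.comp (measurable_id.sub measurable_const)
    have hm2 : Measurable fun z => weight (x - z) * W (z - y) :=
      (measurable_weight.comp (measurable_const.sub measurable_id)).mul hm1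
    rw [← h2, ← lintegral_mul_const _ hm1, ← lintegral_const_mul _ hm2]
    refine lintegral_mono fun z => ?_
    by_cases hz : z - y ∈ Metric.ball (0 : 𝔼) 1
    · rw [mul_comm, ← mul_assoc]
      refine mul_le_mul' (weight_sub_le ?_) le_rfl
      rw [dist_eq_norm]
      simpa using hz
    · rw [hW, Set.indicator_of_notMem hz, zero_mul]
      exact zero_le
  have hwm : Measurable fun y => weight (x - y) :=
    measurable_weight.comp (measurable_const.sub measurable_id)
  have hprod : AEMeasurable (fun q : 𝔼 × 𝔼 => W (q.2 - q.1) * ‖a q.1‖ₑ ^ t)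
      (volume.prod volume) :=
    (hWm.comp (measurable_snd.sub measurable_fst)).aemeasurable.mul ham.comp_fst
  rw [ENNReal.le_div_iff_mul_le (.inl hc0) (.inr ?_)]
  · calc (∫⁻ y, weight (x - y) * ‖a y‖ₑ ^ t) * c
        = ∫⁻ y, c * weight (x - y) * ‖a y‖ₑ ^ t := by
          simp_rw [mul_assoc]
          rw [mul_comm, lintegral_const_mul'' _ (aemeasurable_sub_mul measurable_weight ham x)]
      _ ≤ ∫⁻ y, 2 ^ ((n : ℝ) + 1) * (∫⁻ z, weight (x - z) * W (z - y)) * ‖a y‖ₑ ^ t :=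
          lintegral_mono fun y => mul_le_mul' (h1 y) le_rfl
      _ = ∫⁻ y, ∫⁻ z, 2 ^ ((n : ℝ) + 1) * (weight (x - z) * (W (z - y) * ‖a y‖ₑ ^ t)) := by
          refine lintegral_congr fun y => ?_
          have hm1 : Measurable fun z => W (z - y) := hWm.comp (measurable_id.sub measurable_const)
          have hm2 : Measurable fun z => weight (x - z) :=
            measurable_weight.comp (measurable_const.sub measurable_id)
          rw [lintegral_const_mul _ (by fun_prop), mul_assoc, ← lintegral_mul_const _ (by fun_prop)]
          simp_rw [mul_assoc]
      _ = ∫⁻ z, ∫⁻ y, 2 ^ ((n : ℝ) + 1) * (weight (x - z) * (W (z - y) * ‖a y‖ₑ ^ t)) := by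
          refine lintegral_lintegral_swap ?_
          exact ((measurable_weight.comp (measurable_const.sub measurable_snd)).aemeasurable.mul
            hprod).const_mul _
      _ ≤ ∫⁻ z, 2 ^ ((n : ℝ) + 1) * (weight (x - z) * stummel ν t a) := by
          refine lintegral_mono fun z => ?_
          have hm : AEMeasurable fun y => W (z - y) * ‖a y‖ₑ ^ t := aemeasurable_sub_mul hWm ham z
          rw [lintegral_const_mul'' _ (hm.const_mul _), lintegral_const_mul'' _ hm]
          exact mul_le_mul' le_rfl (mul_le_mul' le_rfl (hst z))
      _ = _ := by
          rw [lintegral_const_mul _ (by fun_prop), lintegral_mul_const _ hwm,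
            lintegral_sub_left_eq weight x, mul_assoc]
  · refine ENNReal.mul_ne_top (ENNReal.mul_ne_top ?_ lintegral_weight_lt_top.ne) hM.ne
    exact ENNReal.rpow_ne_top_of_nonneg (by positivity) (by simp)

/-- Hölder's inequality with a weight that is absorbed by the first factor. -/
theorem lintegral_weight_mul_mul_le {a : 𝔼 → ℂ} {u : 𝔼 → ℝ≥0∞}
    (ha : AEStronglyMeasurable a volume) (hu : AEMeasurable u) {p' p : ℝ}
    (hpp : p'.HolderConjugate p) (x : 𝔼) :
    ∫⁻ y, weight (x - y) * (‖a y‖ₑ * u y) ≤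
      (∫⁻ y, weight (x - y) * ‖a y‖ₑ ^ p') ^ (1 / p') * (∫⁻ y, u y ^ p) ^ (1 / p) := by
  have hwm : Measurable fun y => weight (x - y) :=
    measurable_weight.comp (measurable_const.sub measurable_id)
  have hp0 : 0 < p' := hpp.pos
  have h1 := ENNReal.lintegral_mul_le_Lp_mul_Lq volume hpp
    (f := fun y => weight (x - y) ^ p'⁻¹ * ‖a y‖ₑ) (g := u)
    ((hwm.pow_const _).aemeasurable.mul ha.enorm) hu
  simp_rw [ENNReal.mul_rpow_of_nonneg _ _ hp0.le, ENNReal.rpow_inv_rpow hp0.ne'] at h1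
  refine le_trans (lintegral_mono fun y => ?_) h1
  rw [Pi.mul_apply, mul_assoc]
  refine mul_le_mul' ?_ le_rfl
  nth_rw 1 [← ENNReal.rpow_one (weight (x - y))]
  exact ENNReal.rpow_le_rpow_of_exponent_ge (weight_le_one _) (inv_le_one_of_one_le₀ hpp.lt.le)

/-! ### The eigenvalue equation in the sense of distributions -/

section Eigen

variable {p : ℝ≥0∞} [Fact (1 ≤ p)]

/-- The equation `-Δ (R u) - z R u = u`, with the distributional Laplacian moved onto the test
function. -/
theorem resolvent_pairing {z : ℂ} {R : LpSpace n p →L[ℂ] LpSpace n p}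
    (hR : IsResolvent (freeOp n p) z R) (u : LpSpace n p) (ψ : 𝓢(𝔼, ℂ)) :
    ((R u : LpSpace n p) : 𝓢'(𝔼, ℂ)) (-Δ ψ - z • ψ) = (u : 𝓢'(𝔼, ℂ)) ψ := by
  obtain ⟨hu, h⟩ := hR.1 u
  have h1 : ((freeOp n p ⟨R u, hu⟩ : LpSpace n p) : 𝓢'(𝔼, ℂ)) =
      -Δ ((R u : LpSpace n p) : 𝓢'(𝔼, ℂ)) := (exists_neg_laplacian ⟨R u, hu⟩).choose_spec
  rw [sub_eq_iff_eq_add] at h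
  rw [h, toDist_add, toDist_smul] at h1
  have h2 := DFunLike.congr_fun h1 ψ
  have e1 : ((u : 𝓢'(𝔼, ℂ)) + z • ((R u : LpSpace n p) : 𝓢'(𝔼, ℂ))) ψ =
    (u : 𝓢'(𝔼, ℂ)) ψ + z • ((R u : LpSpace n p) : 𝓢'(𝔼, ℂ)) ψ := rfl
  have e2 : (-Δ ((R u : LpSpace n p) : 𝓢'(𝔼, ℂ))) ψ =
    -((R u : LpSpace n p) : 𝓢'(𝔼, ℂ)) (Δ ψ) :=
      congrArg Neg.neg (TemperedDistribution.laplacian_apply_apply _ _)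
  rw [e1, e2] at h2
  rw [map_sub, map_neg, map_smul, ← h2]
  simp

theorem continuous_integral_mul {q : ℝ≥0∞} [q.HolderConjugate p] {c : 𝔼 → ℂ} (hc : MemLp c q volume) :
    Continuous fun u : LpSpace n p => ∫ x, c x * u x := by
  have : Fact (1 ≤ q) := ⟨ENNReal.HolderConjugate.one_le q p⟩
  have h := ((ContinuousLinearMap.mul ℂ ℂ).lpPairing (volume : Measure 𝔼) q p (hc.toLp c)).continuous
  convert! h using 2 with u
  rw [ContinuousLinearMap.lpPairing_eq_integral]
  refine integral_congr_ae ?_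
  filter_upwards [hc.coeFn_toLp] with x hx
  simp [hx]

/-- On the dense domain of `R A` this is `resolvent_pairing` for `u = a v`. Both sides are
continuous in `v ∈ L_p`, the right one because `ψ a` lies in the dual space. -/
theorem pairing_of_isBoundedExtension {q : ℝ≥0∞} [q.HolderConjugate p] {a : 𝔼 → ℂ} {z : ℂ}
    {R G : LpSpace n p →L[ℂ] LpSpace n p} (hR : IsResolvent (freeOp n p) z R)
    (hG : IsBoundedExtension (pcomp (full R) (mulOp p a)) G) {ψ : 𝓢(𝔼, ℂ)}
    (hψ : MemLp (fun x => ψ x * a x) q volume) (v : LpSpace n p) :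
    ((G v : LpSpace n p) : 𝓢'(𝔼, ℂ)) (-Δ ψ - z • ψ) = ∫ x, ψ x * a x * v x := by
  have hc : Continuous fun v : LpSpace n p =>
      ((G v : LpSpace n p) : 𝓢'(𝔼, ℂ)) (-Δ ψ - z • ψ) := by
    have h1 := (continuous_integral_mul (p := p) (q := q)
      ((-Δ ψ - z • ψ).memLp q volume)).comp G.continuous
    convert! h1 using 2 with u
    exact Lp.toTemperedDistribution_apply (G u) _
  refine congrFun (Continuous.ext_on hG.1 hc (continuous_integral_mul hψ) ?_) v
  rintro u hu
  obtain ⟨hu1, -⟩ := id hu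
  have h1 : G u = R (mulOp p a ⟨u, hu1⟩) := hG.2 ⟨u, hu⟩
  simp only
  rw [h1, resolvent_pairing hR]
  refine (Lp.toTemperedDistribution_apply _ _).trans (integral_congr_ae ?_)
  filter_upwards [mulOp_ae a ⟨u, hu1⟩] with x hx
  rw [hx, smul_eq_mul, mul_assoc]

/-- An eigenfunction of the Schrödinger operator is a distributional solution of
`-Δ f - ev f = -a v` with `v = b f ∈ L_p`. -/
theorem exists_eigenfunction {q : ℝ≥0∞} [q.HolderConjugate p] {a b : 𝔼 → ℂ}
    (ha : ∀ ψ : 𝓢(𝔼, ℂ), MemLp (fun x => ψ x * a x) q volume)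
    {H : LpSpace n p →ₗ.[ℂ] LpSpace n p} (hH : IsSchrodingerOp p a b H) {ev : ℂ}
    (hev : IsEigenvalue H ev) :
    ∃ f v : LpSpace n p, f ≠ 0 ∧ (v =ᵐ[volume] fun x => b x * f x) ∧
      ∀ ψ : 𝓢(𝔼, ℂ), (f : 𝓢'(𝔼, ℂ)) (-Δ ψ - ev • ψ) = -∫ x, ψ x * a x * v x := by
  obtain ⟨z, R, K, G, Q, hR, hK, hG, hQ, hU, rfl⟩ := hH
  obtain ⟨⟨f, hf⟩, hf0, hfe⟩ := hev
  have hker : (full (R - G * Ring.inverse (1 + Q) * K)).toFun.ker = ⊥ := by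
    rw [LinearMap.ker_eq_bot']
    rintro ⟨u, hu⟩ h
    exact Subtype.ext (resolventFormula_injective hR hK hG hQ hU u h)
  set S := R - G * Ring.inverse (1 + Q) * K with hS
  have hfd : f ∈ (full S).inverse.domain := hf
  have hfe' : z • f + (full S).inverse ⟨f, hfd⟩ = ev • f := hfe
  have hfr := hfd
  rw [LinearPMap.inverse_domain] at hfr
  obtain ⟨⟨g, hg⟩, hgf⟩ := hfr
  have hgf' : S g = f := hgf
  have h1 : (full S).inverse ⟨f, hfd⟩ = g :=
    LinearPMap.inverse_apply_eq hker (y := ⟨f, hfd⟩) (x := ⟨g, hg⟩) hgf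
  rw [h1] at hfe'
  -- Since `H = z + S⁻¹`, the eigenvalue equation reads `S⁻¹ f = (ev - z) f`.
  have hgev : g = (ev - z) • f := by
    rw [sub_smul, ← hfe']
    abel
  set w := Ring.inverse (1 + Q) (K g) with hw
  have hfw : f = R g - G w := by
    rw [← hgf', hS]
    rfl
  obtain ⟨h2, h3⟩ := extension_spec hG.2 hQ w
  obtain ⟨h4, h5⟩ := extension_spec (T := full R) (G := R) (fun x => rfl) hK g
  have h6 : (1 + Q) w = K g := by
    have := DFunLike.congr_fun (Ring.mul_inverse_cancel _ hU) (K g)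
    simpa using this
  have hfB : f ∈ (mulOp p b).domain := hfw ▸ (mulOp p b).domain.sub_mem h4 h2
  -- `B f = B R g - B G w = K g - Q w`, and this is `w` because `(1 + Q) w = K g`.
  have h7 : mulOp p b ⟨f, hfB⟩ = w := by
    have e : (⟨f, hfB⟩ : (mulOp p b).domain) = ⟨R g, h4⟩ - ⟨G w, h2⟩ := Subtype.ext hfw
    rw [e, LinearPMap.map_sub, h5, h3, ← h6]
    simp
  refine ⟨f, w, hf0, ?_, fun ψ => ?_⟩
  · rw [← h7]
    exact mulOp_ae b ⟨f, hfB⟩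
  · have e1 := resolvent_pairing hR g ψ
    have e2 := pairing_of_isBoundedExtension hR hG (ha ψ) w
    have e3 : (f : 𝓢'(𝔼, ℂ)) (-Δ ψ - z • ψ) = (ev - z) • (f : 𝓢'(𝔼, ℂ)) ψ -
        ∫ x, ψ x * a x * w x := by
      have e4 : (g : 𝓢'(𝔼, ℂ)) = (ev - z) • (f : 𝓢'(𝔼, ℂ)) := by rw [hgev, toDist_smul]
      have e5 : (f : 𝓢'(𝔼, ℂ)) = ((R g : LpSpace n p) : 𝓢'(𝔼, ℂ)) -
          ((G w : LpSpace n p) : 𝓢'(𝔼, ℂ)) := by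
        conv_lhs => rw [hfw]
        exact (Lp.toTemperedDistributionCLM ℂ volume p).map_sub _ _
      rw [e4] at e1
      conv_lhs => rw [e5]
      have e6 : (((R g : LpSpace n p) : 𝓢'(𝔼, ℂ)) - ((G w : LpSpace n p) : 𝓢'(𝔼, ℂ)))
          (-Δ ψ - z • ψ) = ((R g : LpSpace n p) : 𝓢'(𝔼, ℂ)) (-Δ ψ - z • ψ) -
          ((G w : LpSpace n p) : 𝓢'(𝔼, ℂ)) (-Δ ψ - z • ψ) := rfl
      rw [e6, e1, e2]
      rfl
    have e7 : -Δ ψ - ev • ψ = (-Δ ψ - z • ψ) - (ev - z) • ψ := by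
      rw [sub_smul]
      abel
    rw [e7, map_sub, e3, map_smul]
    abel

end Eigen

/-! ### Schwartz functions against the weight -/

theorem exists_enorm_le_weight (ψ : 𝓢(𝔼, ℂ)) :
    ∃ C : ℝ≥0∞, C ≠ ∞ ∧ ∀ x, ‖ψ x‖ₑ ≤ C * weight x := by
  set C := 2 ^ (n + 1) * (Finset.Iic (n + 1, 0)).sup (fun m => SchwartzMap.seminorm ℝ m.1 m.2) ψ
  have h : ∀ x, (1 + ‖x‖) ^ (n + 1) * ‖ψ x‖ ≤ C := fun x => by
    simpa using SchwartzMap.one_add_le_sup_seminorm_apply (𝕜 := ℝ) (m := (n + 1, 0)) le_rfl le_rfl ψ x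
  have hC : 0 ≤ C := le_trans (by positivity) (h 0)
  refine ⟨ENNReal.ofReal C, ENNReal.ofReal_ne_top, fun x => ?_⟩
  rw [weight, ← ENNReal.ofReal_mul hC, ← ofReal_norm]
  refine ENNReal.ofReal_le_ofReal ?_
  have h2 : (1 + ‖x‖) ^ (-((n : ℝ) + 1)) = ((1 + ‖x‖) ^ (n + 1))⁻¹ := by
    rw [Real.rpow_neg (by positivity), ← Real.rpow_natCast]
    push_cast
    rfl
  rw [h2, ← div_eq_mul_inv, le_div_iff₀ (by positivity), mul_comm]
  exact h x

/-- Puts `ψ a` in `L_{p'}`, so that it can be paired with `v ∈ L_p` even when no global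
integrability of `a` provides this. -/
theorem memLp_schwartz_mul {a : 𝔼 → ℂ} (ha : AEStronglyMeasurable a volume) {t : ℝ} (ht : 1 ≤ t)
    (hM : ∫⁻ y, weight y * ‖a y‖ₑ ^ t < ∞) (ψ : 𝓢(𝔼, ℂ)) :
    MemLp (fun x => ψ x * a x) (ENNReal.ofReal t) volume := by
  obtain ⟨C, hC, hψ⟩ := exists_enorm_le_weight ψ
  have ht0 : 0 < t := by linarith
  refine ⟨ψ.continuous.aestronglyMeasurable.mul ha, ?_⟩
  rw [eLpNorm_lt_top_iff_lintegral_rpow_enorm_lt_top (by simpa using ht0) ENNReal.ofReal_ne_top,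
    ENNReal.toReal_ofReal ht0.le]
  refine lt_of_le_of_lt (b := ∫⁻ y, C ^ t * (weight y * ‖a y‖ₑ ^ t)) (lintegral_mono fun x => ?_) ?_
  · rw [enorm_mul, ENNReal.mul_rpow_of_nonneg _ _ ht0.le, ← mul_assoc]
    refine mul_le_mul' ?_ le_rfl
    refine (ENNReal.rpow_le_rpow (hψ x) ht0.le).trans ?_
    rw [ENNReal.mul_rpow_of_nonneg _ _ ht0.le]
    refine mul_le_mul' le_rfl ?_
    nth_rw 2 [← ENNReal.rpow_one (weight x)]
    exact ENNReal.rpow_le_rpow_of_exponent_ge (weight_le_one _) ht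
  · rw [lintegral_const_mul' _ _ (ENNReal.rpow_ne_top_of_nonneg ht0.le hC)]
    exact ENNReal.mul_lt_top (ENNReal.rpow_lt_top_of_nonneg ht0.le hC) hM

/-! ### The pointwise estimate of the eigenfunction -/

/-- The decay of the Green kernel supplies a factor `weight (x - y)`. Together with `weight x` it is
at most `weight y`, and the kernel that remains is integrable. -/
theorem lintegral_weight_mul_conv_lt_top {κ : ℝ} (hκ : 0 < κ) {g : 𝔼 → ℝ≥0∞}
    (hg : AEMeasurable g) (hw : ∫⁻ y, weight y * g y < ∞) :
    ∫⁻ x : 𝔼, weight x * ∫⁻ y, greenKernel κ 4 (x - y) * g y < ∞ := by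
  obtain ⟨C, hC, hk⟩ := exists_greenKernel_le_weight (n := n) hκ
  have hk1 := lintegral_greenKernel_rpow_le (n := n) (κ := κ / 2) (D := 8) (β := 1)
    (by positivity) (by norm_num) le_rfl (by norm_num)
  simp only [ENNReal.rpow_one] at hk1
  have hm4 := measurable_greenKernel (n := n) κ 4
  have hm8 := measurable_greenKernel (n := n) (κ / 2) 8
  calc ∫⁻ x : 𝔼, weight x * ∫⁻ y, greenKernel κ 4 (x - y) * g y
      = ∫⁻ x : 𝔼, ∫⁻ y, weight x * (greenKernel κ 4 (x - y) * g y) :=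
        lintegral_congr fun x => (lintegral_const_mul'' _ (aemeasurable_sub_mul hm4 hg x)).symm
    _ = ∫⁻ y : 𝔼, ∫⁻ x, weight x * (greenKernel κ 4 (x - y) * g y) := by
        refine lintegral_lintegral_swap ?_
        exact (measurable_weight.comp measurable_fst).aemeasurable.mul
          (aemeasurable_prod_sub_mul hm4 hg)
    _ ≤ ∫⁻ y : 𝔼, ∫⁻ x, C * (weight y * g y) * greenKernel (κ / 2) 8 (x - y) := by
        refine lintegral_mono fun y => lintegral_mono fun x => ?_
        calc weight x * (greenKernel κ 4 (x - y) * g y)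
            ≤ weight x * (C * weight (x - y) * greenKernel (κ / 2) 8 (x - y) * g y) := by
              gcongr
              exact hk _
          _ = C * ((weight (x - y) * weight x) * g y) * greenKernel (κ / 2) 8 (x - y) := by ring
          _ ≤ _ := by
              gcongr
              exact weight_sub_mul_weight_le x y
    _ ≤ ∫⁻ y : 𝔼, C * (weight y * g y) * ENNReal.ofReal (greenBound n (κ / 2) 8 1) := by
        refine lintegral_mono fun y => ?_
        have hm : Measurable fun x : 𝔼 => greenKernel (κ / 2) 8 (x - y) :=
          hm8.comp (measurable_id.sub measurable_const)
        rw [lintegral_const_mul _ hm]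
        refine mul_le_mul' le_rfl ?_
        rw [lintegral_sub_right_eq_self (fun x : 𝔼 => greenKernel (κ / 2) 8 x) y]
        exact hk1
    _ < ∞ := by
        rw [lintegral_mul_const' _ _ ENNReal.ofReal_ne_top, lintegral_const_mul' _ _ hC]
        exact ENNReal.mul_lt_top (ENNReal.mul_lt_top hC.lt_top hw) ENNReal.ofReal_lt_top

theorem locallyIntegrable_toReal_of_weight {h : 𝔼 → ℝ≥0∞} (hm : AEMeasurable h)
    (hw : ∫⁻ x, weight x * h x < ∞) : LocallyIntegrable (fun x => (h x).toReal) volume := by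
  have h1 : Integrable (fun x => (weight x * h x).toReal) volume :=
    integrable_toReal_of_lintegral_ne_top (measurable_weight.aemeasurable.mul hm) hw.ne
  have h2 : Continuous fun x : 𝔼 => (1 + ‖x‖) ^ (n + 1) := by fun_prop
  refine (h1.locallyIntegrable.continuous_mul h2).congr (.of_forall fun x => ?_)
  simp only [ENNReal.toReal_mul]
  rw [weight, ENNReal.toReal_ofReal (by positivity), ← mul_assoc, Real.rpow_neg (by positivity),
    ← Nat.cast_add_one, Real.rpow_natCast, mul_inv_cancel₀ (by positivity), one_mul]

/-- Testing with normalized bumps that shrink to `x` gives the bound for local averages; Lebesgue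
differentiation of `f` and `h` gives it almost everywhere. The ratio of outer to inner radius stays
at `2`, as differentiation requires. -/
theorem ae_enorm_le_of_forall_schwartz {f : 𝔼 → ℂ} (hf : LocallyIntegrable f volume)
    {h : 𝔼 → ℝ≥0∞} (hm : AEMeasurable h) (hw : ∫⁻ x, weight x * h x < ∞)
    (hfh : ∀ φ : 𝓢(𝔼, ℂ), ‖∫ x, φ x * f x‖ₑ ≤ ∫⁻ x, ‖φ x‖ₑ * h x) :
    ∀ᵐ x, ‖f x‖ₑ ≤ h x := by
  have hH := locallyIntegrable_toReal_of_weight hm hw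
  have hfin : ∀ᵐ x, h x < ∞ := by
    filter_upwards [ae_lt_top' (measurable_weight.aemeasurable.mul hm) hw.ne] with x hx
    exact ENNReal.lt_top_of_mul_ne_top_right hx.ne (weight_ne_zero x)
  let φ : ℕ → ContDiffBump (0 : 𝔼) := fun i =>
    { rIn := 1 / ((i : ℝ) + 1), rOut := 2 * (1 / ((i : ℝ) + 1)),
      rIn_pos := by positivity, rIn_lt_rOut := by
        have : 0 < 1 / ((i : ℝ) + 1) := by positivity
        linarith }
  have hφ : Filter.Tendsto (fun i => (φ i).rOut) Filter.atTop (nhds 0) := by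
    have h := (tendsto_one_div_add_atTop_nhds_zero_nat (𝕜 := ℝ)).const_mul 2
    rw [mul_zero] at h
    exact h
  have hφ' : ∀ᶠ i in Filter.atTop, (φ i).rOut ≤ 2 * (φ i).rIn := .of_forall fun i => le_rfl
  filter_upwards [ContDiffBump.ae_convolution_tendsto_right_of_locallyIntegrable hφ hφ' hf,
    ContDiffBump.ae_convolution_tendsto_right_of_locallyIntegrable hφ hφ' hH, hfin] with x h1 h2 h3
  have h4 : ‖f x‖ ≤ (h x).toReal := by
    refine le_of_tendsto_of_tendsto' h1.norm h2 fun i => ?_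
    set ρ : 𝔼 → ℝ := fun y => (φ i).normed volume (x - y) with hρ
    have hρ0 : ∀ y, 0 ≤ ρ y := fun y => (φ i).nonneg_normed _
    have hρc : HasCompactSupport ρ :=
      (φ i).hasCompactSupport_normed.comp_homeomorph (Homeomorph.subLeft x)
    have hρs : ContDiff ℝ (⊤ : ℕ∞) ρ :=
      (φ i).contDiff_normed.comp (contDiff_const.sub contDiff_id)
    have hc : HasCompactSupport fun y => (ρ y : ℂ) := hρc.comp_left Complex.ofReal_zero
    have hs : ContDiff ℝ (⊤ : ℕ∞) fun y => (ρ y : ℂ) := Complex.ofRealCLM.contDiff.comp hρs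
    have h5 := hfh (hc.toSchwartzMap hs)
    have hint : Integrable (fun y => ρ y * (h y).toReal) volume := by
      have := hH.integrable_smul_left_of_hasCompactSupport hρs.continuous hρc
      simpa using this
    rw [convolution_lsmul_swap, convolution_lsmul_swap]
    have e1 : ∫ y, (φ i).normed volume (x - y) • f y = ∫ y, hc.toSchwartzMap hs y * f y := by
      refine integral_congr_ae (.of_forall fun y => ?_)
      simp [hρ]
    have e2 : ∫⁻ y, ‖hc.toSchwartzMap hs y‖ₑ * h y =
        ENNReal.ofReal (∫ y, (φ i).normed volume (x - y) • (h y).toReal) := by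
      simp only [smul_eq_mul]
      rw [ofReal_integral_eq_lintegral_ofReal hint
        (.of_forall fun y => mul_nonneg (hρ0 y) ENNReal.toReal_nonneg)]
      refine lintegral_congr_ae ?_
      filter_upwards [hfin] with y hy
      rw [ENNReal.ofReal_mul (hρ0 y), ENNReal.ofReal_toReal hy.ne, ← ofReal_norm]
      congr 2
      simp [abs_of_nonneg (hρ0 y)]
    rw [e1]
    rw [e2, ← ofReal_norm] at h5
    exact (ENNReal.ofReal_le_ofReal_iff (integral_nonneg fun y =>
      mul_nonneg (hρ0 y) ENNReal.toReal_nonneg)).1 h5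
  rw [← ofReal_norm]
  exact ENNReal.ofReal_le_of_le_toReal h4

/-- A distributional solution of `-Δ f - ev f = -a v` is dominated by the convolution of `|a v|`
with the Green kernel. -/
theorem ae_enorm_le_conv {p : ℝ≥0∞} [Fact (1 ≤ p)] {f v : LpSpace n p} {a : 𝔼 → ℂ}
    (ha : AEStronglyMeasurable a volume) {ev : ℂ} (hre : ev.re < 0)
    (hw : ∫⁻ y, weight y * (‖a y‖ₑ * ‖v y‖ₑ) < ∞)
    (hf : ∀ ψ : 𝓢(𝔼, ℂ), (f : 𝓢'(𝔼, ℂ)) (-Δ ψ - ev • ψ) = -∫ x, ψ x * a x * v x) :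
    ∀ᵐ x, ‖f x‖ₑ ≤ ∫⁻ y, greenKernel (-ev.re) 4 (x - y) * (‖a y‖ₑ * ‖v y‖ₑ) := by
  have hκ : 0 < -ev.re := by linarith
  have hm4 := measurable_greenKernel (n := n) (-ev.re) 4
  have hg : AEMeasurable fun y => ‖a y‖ₑ * ‖v y‖ₑ := ha.enorm.mul (Lp.aestronglyMeasurable v).enorm
  have hprod := aemeasurable_prod_sub_mul hm4 hg
  refine ae_enorm_le_of_forall_schwartz ((Lp.memLp f).locallyIntegrable Fact.out)
    hprod.lintegral_prod_right' (lintegral_weight_mul_conv_lt_top hκ hg hw) fun φ => ?_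
  -- For this test function the left side is the pairing of `f` with `φ`. The kernel bound and the
  -- symmetry of the kernel then move the convolution onto `|a v|`.
  have h1 := hf (schwartzResolvent ev φ)
  rw [laplacian_schwartzResolvent hre] at h1
  have h2 : (f : 𝓢'(𝔼, ℂ)) φ = ∫ x, φ x * f x := Lp.toTemperedDistribution_apply _ _
  rw [← h2, h1, enorm_neg]
  have hφ := φ.continuous.measurable.enorm
  calc _ ≤ ∫⁻ y, ‖schwartzResolvent ev φ y * a y * v y‖ₑ := enorm_integral_le_lintegral_enorm _
    _ ≤ ∫⁻ y, (∫⁻ x, greenKernel (-ev.re) 4 (y - x) * ‖φ x‖ₑ) * (‖a y‖ₑ * ‖v y‖ₑ) := by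
        refine lintegral_mono fun y => ?_
        rw [enorm_mul, enorm_mul, mul_assoc]
        exact mul_le_mul' (enorm_schwartzResolvent_le hre φ y) le_rfl
    _ = ∫⁻ y, ∫⁻ x, ‖φ x‖ₑ * (greenKernel (-ev.re) 4 (x - y) * (‖a y‖ₑ * ‖v y‖ₑ)) := by
        refine lintegral_congr fun y => ?_
        rw [← lintegral_mul_const'' _ (aemeasurable_sub_mul hm4 hφ.aemeasurable y)]
        refine lintegral_congr fun x => ?_
        rw [← greenKernel_neg, neg_sub]
        ring
    _ = ∫⁻ x, ∫⁻ y, ‖φ x‖ₑ * (greenKernel (-ev.re) 4 (x - y) * (‖a y‖ₑ * ‖v y‖ₑ)) := by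
        refine (lintegral_lintegral_swap ?_).symm
        exact (hφ.comp measurable_fst).aemeasurable.mul hprod
    _ = _ := lintegral_congr fun x => lintegral_const_mul'' _ (aemeasurable_sub_mul hm4 hg x)

/-- A function dominated by the convolution of `|a v|` with the Green kernel lies in `L_α`, if `a`
is locally uniformly in `L_p'` and `v ∈ L_p`. -/
theorem memLp_of_ae_enorm_le_conv {κ : ℝ} (hκ : 0 < κ) {a v f : 𝔼 → ℂ}
    (ha : AEStronglyMeasurable a volume) (hf : AEStronglyMeasurable f volume)
    {P P' : ℝ} (hPP : P'.HolderConjugate P) (hv : ∫⁻ y, ‖v y‖ₑ ^ P < ∞)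
    (hvm : AEStronglyMeasurable v volume) {M : ℝ≥0∞} (hM : M ≠ ∞)
    (haM : ∀ x, ∫⁻ y, weight (x - y) * ‖a y‖ₑ ^ P' ≤ M) {α : ℝ} (hPα : P ≤ α)
    (hαn : n / 2 * (1 - 1 / α) < 1)
    (hfk : ∀ᵐ x, ‖f x‖ₑ ≤ ∫⁻ y, greenKernel κ 4 (x - y) * (‖a y‖ₑ * ‖v y‖ₑ)) :
    MemLp f (ENNReal.ofReal α) volume := by
  obtain ⟨C, hC, hk⟩ := exists_greenKernel_le_weight (n := n) hκ
  have hP0 : 0 < P := hPP.symm.pos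
  have hP1 : 1 ≤ P := hPP.symm.lt.le
  have hα0 : 0 < α := by linarith
  have hP'0 : 0 < P' := hPP.pos
  have hm8 := measurable_greenKernel (n := n) (κ / 2) 8
  have hk8 := lintegral_greenKernel_rpow_le (n := n) (κ := κ / 2) (D := 8) (β := α)
    (by positivity) (by norm_num) (by linarith) hαn
  set I : 𝔼 → ℝ≥0∞ := fun x => ∫⁻ y, greenKernel (κ / 2) 8 (x - y) ^ P * ‖v y‖ₑ ^ P with hI
  -- Young for `P`-th powers: the kernel to the power `P` lies in `L_{α/P}` and `|v|^P` in `L_1`, so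
  -- `I ∈ L_{α/P}`.
  have hY := lintegral_conv_rpow_le (hm8.pow_const P) (hvm.enorm.pow_const P) (A := P / α) (S := 1)
    (T := P / α) (by positivity) ((div_le_one hα0).2 hPα) one_pos le_rfl (by positivity) (by ring)
  have hIint : ∫⁻ x, I x ^ (α / P) < ∞ := by
    rw [inv_div] at hY
    refine hY.trans_lt ?_
    simp_rw [← ENNReal.rpow_mul, mul_div_cancel₀ α hP0.ne', inv_one, mul_one, ENNReal.rpow_one]
    refine ENNReal.rpow_lt_top_of_nonneg (by positivity) (ENNReal.mul_ne_top ?_ hv.ne)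
    refine ENNReal.rpow_ne_top_of_nonneg (by positivity) (hk8.trans_lt ?_).ne
    exact ENNReal.rpow_lt_top_of_nonneg hα0.le ENNReal.ofReal_ne_top
  -- Hölder with the split kernel: the weight goes with `a` and costs the uniform constant `M`,
  -- while the kernel with parameters `κ/2`, `8` goes with `v` and yields `I`.
  have h1 : ∀ᵐ x, ‖f x‖ₑ ≤ C * M ^ (1 / P') * I x ^ (1 / P) := by
    filter_upwards [hfk] with x hx
    refine hx.trans ?_
    have hm : Measurable fun y : 𝔼 => greenKernel (κ / 2) 8 (x - y) :=
      hm8.comp (measurable_const.sub measurable_id)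
    have hu : AEMeasurable fun y => greenKernel (κ / 2) 8 (x - y) * ‖v y‖ₑ :=
      hm.aemeasurable.mul hvm.enorm
    calc ∫⁻ y, greenKernel κ 4 (x - y) * (‖a y‖ₑ * ‖v y‖ₑ)
        ≤ ∫⁻ y, C * (weight (x - y) * (‖a y‖ₑ * (greenKernel (κ / 2) 8 (x - y) * ‖v y‖ₑ))) := by
          refine lintegral_mono fun y => ?_
          refine (mul_le_mul' (hk (x - y)) le_rfl).trans (le_of_eq ?_)
          ring
      _ = C * ∫⁻ y, weight (x - y) * (‖a y‖ₑ * (greenKernel (κ / 2) 8 (x - y) * ‖v y‖ₑ)) :=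
          lintegral_const_mul' _ _ hC
      _ ≤ C * (M ^ (1 / P') * I x ^ (1 / P)) := by
          refine mul_le_mul' le_rfl ((lintegral_weight_mul_mul_le ha hu hPP x).trans ?_)
          refine mul_le_mul' (ENNReal.rpow_le_rpow (haM x) (by positivity)) (le_of_eq ?_)
          simp_rw [hI, ENNReal.mul_rpow_of_nonneg _ _ hP0.le]
      _ = _ := by rw [mul_assoc]
  refine ⟨hf, ?_⟩
  rw [eLpNorm_lt_top_iff_lintegral_rpow_enorm_lt_top (by simpa using hα0) ENNReal.ofReal_ne_top,
    ENNReal.toReal_ofReal hα0.le]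
  have hD : (C * M ^ (1 / P')) ^ α ≠ ∞ := ENNReal.rpow_ne_top_of_nonneg hα0.le
    (ENNReal.mul_ne_top hC (ENNReal.rpow_ne_top_of_nonneg (by positivity) hM))
  refine lt_of_le_of_lt (b := ∫⁻ x, (C * M ^ (1 / P')) ^ α * I x ^ (α / P))
    (lintegral_mono_ae ?_) ?_
  · filter_upwards [h1] with x hx
    refine (ENNReal.rpow_le_rpow hx hα0.le).trans (le_of_eq ?_)
    rw [ENNReal.mul_rpow_of_nonneg _ _ hα0.le, ← ENNReal.rpow_mul, one_div_mul_eq_div]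
  · rw [lintegral_const_mul' _ _ hD]
    exact ENNReal.mul_lt_top hD.lt_top hIint

/-! ### The Birman–Schwinger estimate -/

/-- The norm estimate of the Birman–Schwinger operator, applied to an eigenfunction. -/
theorem one_le_of_ae_enorm_le_conv {κ : ℝ} (hκ : 0 < κ) {a b v f : 𝔼 → ℂ} {r s q : ℝ≥0∞}
    (ha : MemLp a r volume) (hb : MemLp b s volume) (hf : AEStronglyMeasurable f volume)
    (hv : MemLp v q volume) (hv0 : ¬ v =ᵐ[volume] 0) (hq0 : q ≠ 0) (hqt : q ≠ ∞)
    (hrq : r⁻¹ + q⁻¹ ≤ 1) (hsq : s⁻¹ ≤ q⁻¹) {α : ℝ} (hα : 1 ≤ α)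
    (hαrs : 1 / α = 1 - r⁻¹.toReal - s⁻¹.toReal) (hαn : n / 2 * (1 - 1 / α) < 1)
    (hvb : v =ᵐ[volume] fun x => b x * f x)
    (hfk : ∀ᵐ x, ‖f x‖ₑ ≤ ∫⁻ y, greenKernel κ 4 (x - y) * (‖a y‖ₑ * ‖v y‖ₑ)) :
    1 ≤ eLpNorm b s volume * (ENNReal.ofReal (greenBound n κ 4 α) * eLpNorm a r volume) := by
  have hα0 : 0 < α := by linarith
  have hm4 := measurable_greenKernel (n := n) κ 4
  have hqi : q⁻¹ ≠ ∞ := by simpa using hq0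
  have hqi0 : q⁻¹ ≠ 0 := by simpa using hqt
  have hri : r⁻¹ ≠ ∞ := ((le_self_add.trans hrq).trans_lt ENNReal.one_lt_top).ne
  have hsi : s⁻¹ ≠ ∞ := (hsq.trans_lt hqi.lt_top).ne
  -- `a v ∈ L_σ` and `f ∈ L_τ`. Since `1/τ - 1/σ = -1/r - 1/s = 1/α - 1`, Young with the kernel in
  -- `L_α` leads from `σ` to `τ`, and multiplication by `b` leads back to `q`.
  set σ := (r⁻¹ + q⁻¹)⁻¹ with hσ
  set τ := (q⁻¹ - s⁻¹)⁻¹ with hτ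
  have t1 : ENNReal.HolderTriple r q σ := ⟨by rw [hσ, inv_inv]⟩
  have t2 : ENNReal.HolderTriple s τ q := ⟨by rw [hτ, inv_inv, add_tsub_cancel_of_le hsq]⟩
  have hσt : σ ≠ ∞ := by
    rw [hσ, ENNReal.inv_ne_top]
    simp [hqi0]
  have hσ1 : 1 ≤ σ := by rw [hσ]; exact ENNReal.one_le_inv.2 hrq
  have hτ0 : τ ≠ 0 := by
    rw [hτ, ENNReal.inv_ne_zero]
    exact (tsub_le_self.trans_lt hqi.lt_top).ne
  have hσr : σ⁻¹.toReal = r⁻¹.toReal + q⁻¹.toReal := by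
    rw [hσ, inv_inv, ENNReal.toReal_add hri hqi]
  have hτr : τ⁻¹.toReal = q⁻¹.toReal - s⁻¹.toReal := by
    rw [hτ, inv_inv, ENNReal.toReal_sub_of_le hsq hqi]
  have hg : AEMeasurable fun y => ‖a y‖ₑ * ‖v y‖ₑ := ha.1.enorm.mul hv.1.enorm
  have hk := lintegral_greenKernel_rpow_le (n := n) (κ := κ) (D := 4) (β := α) hκ
    (by norm_num) hα hαn
  have hY := eLpNorm_conv_le hm4 hg (A := 1 / α) (by positivity) (by rw [div_le_one hα0]; exact hα)
    hσ1 hσt (τ := τ) (by rw [hτr, hσr, hαrs]; ring) hτ0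
  have hk' : (∫⁻ y : 𝔼, greenKernel κ 4 y ^ (1 / α)⁻¹) ^ (1 / α) ≤
      ENNReal.ofReal (greenBound n κ 4 α) := by
    rw [one_div, inv_inv]
    refine (ENNReal.rpow_le_rpow hk (by positivity)).trans (le_of_eq ?_)
    rw [ENNReal.rpow_rpow_inv hα0.ne']
  have hav : eLpNorm (fun y => ‖a y‖ₑ * ‖v y‖ₑ) σ volume ≤
      eLpNorm a r volume * eLpNorm v q volume := by
    refine le_trans (le_of_eq ?_) (eLpNorm_smul_le_mul_eLpNorm (r := σ) hv.1 ha.1)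
    refine eLpNorm_congr_enorm_ae (.of_forall fun x => ?_)
    simp
  have hfτ : eLpNorm f τ volume ≤ ENNReal.ofReal (greenBound n κ 4 α) *
      (eLpNorm a r volume * eLpNorm v q volume) := by
    refine (eLpNorm_mono_enorm_ae (g := fun x => ∫⁻ y, greenKernel κ 4 (x - y) *
      (‖a y‖ₑ * ‖v y‖ₑ)) ?_).trans (hY.trans (mul_le_mul' hk' hav))
    simpa using hfk
  have hvq : eLpNorm v q volume ≤ eLpNorm b s volume * eLpNorm f τ volume := by
    have hvb' : v =ᵐ[volume] b • f := hvb.trans (.of_forall fun x => by simp)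
    rw [eLpNorm_congr_ae hvb']
    exact eLpNorm_smul_le_mul_eLpNorm (r := q) hf hb.1
  have hne : eLpNorm v q volume ≠ 0 := fun h => hv0 ((eLpNorm_eq_zero_iff hv.1 hq0).1 h)
  have h1 : 1 * eLpNorm v q volume ≤ eLpNorm b s volume *
      (ENNReal.ofReal (greenBound n κ 4 α) * eLpNorm a r volume) * eLpNorm v q volume := by
    rw [one_mul]
    refine hvq.trans ((mul_le_mul' le_rfl hfτ).trans (le_of_eq ?_))
    ring
  exact (ENNReal.mul_le_mul_iff_left hne hv.2.ne).1 h1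

end SchrodingerLp

end

/-! ### The eigenvalue bound -/

theorem mainTheorem3 (n : ℕ) (hn : 3 ≤ n)
    (p : ℝ≥0∞) [Fact (1 ≤ p)] (hp1 : 1 < p) (hp : p < ∞)
    (r s : ℝ≥0∞) (hr : 0 < r) (hs : p ≤ s) (hrs : r⁻¹ + s⁻¹ < 2 / (n : ℝ≥0∞))
    (a b : EuclideanSpace ℝ (Fin n) → ℂ)
    (ha : MemLp a r volume) (hb : MemLp b s volume)
    (hMa : ∃ ν : ℝ, 0 < ν ∧ ν < p.toReal.conjExponent ∧
      SchrodingerLp.stummel ν p.toReal.conjExponent a < ∞)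
    (hMb : ∃ μ : ℝ, 0 < μ ∧ μ < p.toReal ∧ SchrodingerLp.stummel μ p.toReal b < ∞)
    (hq : Filter.Tendsto
      (fun x : EuclideanSpace ℝ (Fin n) => ∫⁻ y in Metric.ball x 1, ‖a y * b y‖ₑ)
      (Filter.cocompact _) (nhds 0))
    (H : SchrodingerLp.LpSpace n p →ₗ.[ℂ] SchrodingerLp.LpSpace n p)
    (hH : SchrodingerLp.IsSchrodingerOp p a b H)
    (ev : ℂ) (hev : SchrodingerLp.IsEigenvalue H ev) (hre : ev.re < 0)
    (α : ℝ) (hα : α = (1 - r⁻¹.toReal - s⁻¹.toReal)⁻¹) :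
    |ev.re| ^ (1 - n / 2 * (1 - 1 / α)) ≤
      (4 * Real.pi) ^ (-(n / 2 * (1 - 1 / α))) * α ^ (-(n / (2 * α))) *
        Real.Gamma (1 - n / 2 * (1 - 1 / α)) *
        (eLpNorm a r volume).toReal * (eLpNorm b s volume).toReal := by
  open SchrodingerLp in
  have hn3 : (3 : ℝ) ≤ n := by exact_mod_cast hn
  have h2n : (2 / (n : ℝ≥0∞)) < 1 := by
    refine ENNReal.div_lt_of_lt_mul ?_
    rw [one_mul]
    exact_mod_cast (by omega : 2 < n)
  have hrs1 : r⁻¹ + s⁻¹ < 1 := hrs.trans h2n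
  have hri : r⁻¹ ≠ ∞ := ((le_self_add.trans_lt hrs1).trans ENNReal.one_lt_top).ne
  have hsi : s⁻¹ ≠ ∞ := ((le_add_self.trans_lt hrs1).trans ENNReal.one_lt_top).ne
  set x := r⁻¹.toReal with hx
  set y := s⁻¹.toReal with hy
  have hx0 : 0 ≤ x := ENNReal.toReal_nonneg
  have hy0 : 0 ≤ y := ENNReal.toReal_nonneg
  have hxy : x + y < 2 / n := by
    have := (ENNReal.toReal_lt_toReal (ENNReal.add_ne_top.2 ⟨hri, hsi⟩)
      (h2n.trans ENNReal.one_lt_top).ne).2 hrs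
    rwa [ENNReal.toReal_add hri hsi, ENNReal.toReal_div, ENNReal.toReal_ofNat,
      ENNReal.toReal_natCast] at this
  have hxy1 : x + y < 1 := hxy.trans_le (by rw [div_le_one (by linarith)]; linarith)
  have hαinv : 1 / α = 1 - x - y := by rw [hα, one_div, inv_inv]
  have hα1 : 1 ≤ α := by rw [hα]; exact (one_le_inv₀ (by linarith)).2 (by linarith)
  have hα0 : 0 < α := by linarith
  have hαn : n / 2 * (1 - 1 / α) < 1 := by
    rw [hαinv]
    rw [lt_div_iff₀ (by linarith)] at hxy
    linarith
  have hP1 : 1 < p.toReal := by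
    simpa using (ENNReal.toReal_lt_toReal ENNReal.one_ne_top hp.ne).2 hp1
  have hPP : p.toReal.conjExponent.HolderConjugate p.toReal :=
    (Real.HolderConjugate.conjExponent hP1).symm
  have hp0 : p ≠ 0 := (one_pos.trans hp1).ne'
  have hpc : (ENNReal.ofReal p.toReal.conjExponent).HolderConjugate p := by
    have := hPP.ennrealOfReal
    rwa [ENNReal.ofReal_toReal hp.ne] at this
  -- local bounds for `a` and the eigenfunction
  obtain ⟨ν, -, -, hν⟩ := hMa
  obtain ⟨M, hM, haM⟩ := exists_lintegral_weight_mul_le hn ha.1 hν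
  have haM0 : ∫⁻ y, weight y * ‖a y‖ₑ ^ p.toReal.conjExponent < ∞ := by
    refine lt_of_le_of_lt (le_trans (le_of_eq ?_) (haM 0)) hM.lt_top
    simp [weight_neg]
  obtain ⟨f, v, hf0, hvb, hfv⟩ :=
    exists_eigenfunction (fun ψ => memLp_schwartz_mul ha.1 hPP.lt.le haM0 ψ) hH hev
  have hvm := Lp.aestronglyMeasurable v
  have hvP : ∫⁻ y, ‖v y‖ₑ ^ p.toReal < ∞ :=
    (eLpNorm_lt_top_iff_lintegral_rpow_enorm_lt_top hp0 hp.ne).1 (Lp.memLp v).2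
  have hw : ∫⁻ y, weight y * (‖a y‖ₑ * ‖v y‖ₑ) < ∞ := by
    have h := lintegral_weight_mul_mul_le ha.1 hvm.enorm hPP 0
    simp only [zero_sub, weight_neg] at h
    refine h.trans_lt (ENNReal.mul_lt_top ?_ ?_)
    · exact ENNReal.rpow_lt_top_of_nonneg (one_div_nonneg.2 hPP.nonneg) haM0.ne
    · exact ENNReal.rpow_lt_top_of_nonneg (by positivity) hvP.ne
  have hfk := ae_enorm_le_conv ha.1 hre hw hfv
  have hκ : 0 < -ev.re := by linarith
  -- If `v = 0`, the kernel bound forces `f = 0`, against the choice of an eigenfunction.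
  have hv0 : ¬ v =ᵐ[volume] 0 := by
    intro hv
    refine hf0 (Lp.ext ?_)
    have h0 : ∀ x, ∫⁻ y, greenKernel (-ev.re) 4 (x - y) * (‖a y‖ₑ * ‖v y‖ₑ) = 0 := fun x => by
      rw [lintegral_eq_zero_iff' (aemeasurable_sub_mul (h := fun y => ‖a y‖ₑ * ‖v y‖ₑ)
        (measurable_greenKernel _ _) (ha.1.enorm.mul hvm.enorm) x)]
      filter_upwards [hv] with y hy
      simp [hy]
    filter_upwards [hfk, Lp.coeFn_zero ℂ p (volume : Measure (EuclideanSpace ℝ (Fin n)))] with x hx hx0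
    rw [h0, nonpos_iff_eq_zero, enorm_eq_zero] at hx
    rw [hx, hx0, Pi.zero_apply]
  -- the main estimate
  have main : 1 ≤ eLpNorm b s volume *
      (ENNReal.ofReal (greenBound n (-ev.re) 4 α) * eLpNorm a r volume) := by
    by_cases hrp : r⁻¹ + p⁻¹ ≤ 1
    · exact one_le_of_ae_enorm_le_conv hκ ha hb (Lp.aestronglyMeasurable f) (Lp.memLp v) hv0 hp0
        hp.ne hrp (ENNReal.inv_le_inv.2 hs) hα1 hαinv hαn hvb hfk
    -- Here `1/r > 1 - 1/p`, hence `1/α < 1/p`. With `q = r'` the exponents of the Birman–Schwinger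
    -- estimate are `σ = 1` and `τ = α`. That `v ∈ L_q` follows from `f ∈ L_α` and `b ∈ L_s`.
    · have hr1 : r⁻¹ < 1 := le_self_add.trans_lt hrs1
      have hrp' : 1 < x + p.toReal⁻¹ := by
        rw [not_le] at hrp
        have hpi : p⁻¹ ≠ ∞ := by simpa using hp0
        have := (ENNReal.toReal_lt_toReal ENNReal.one_ne_top (ENNReal.add_ne_top.2 ⟨hri, hpi⟩)).2 hrp
        rwa [ENNReal.toReal_add hri hpi, ENNReal.toReal_one, ENNReal.toReal_inv p] at this
      have hPα : p.toReal ≤ α := by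
        rw [← inv_le_inv₀ hα0 (by linarith), ← one_div, hαinv]
        linarith
      have hfα := memLp_of_ae_enorm_le_conv hκ ha.1 (Lp.aestronglyMeasurable f) hPP hvP hvm hM haM
        hPα hαn hfk
      set q := (1 - r⁻¹)⁻¹ with hqdef
      have htri : ENNReal.HolderTriple s (ENNReal.ofReal α) q := by
        constructor
        rw [hqdef, inv_inv, ← ENNReal.ofReal_inv_of_pos hα0, ← one_div α, hαinv,
          ← ENNReal.toReal_eq_toReal_iff' (by simp [hsi]) (by simp),
          ENNReal.toReal_add hsi ENNReal.ofReal_ne_top, ENNReal.toReal_ofReal (by linarith),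
          ENNReal.toReal_sub_of_le hr1.le ENNReal.one_ne_top, ENNReal.toReal_one]
        ring
      have hvq : MemLp v q volume := (hfα.smul (r := q) hb).ae_eq hvb.symm
      refine one_le_of_ae_enorm_le_conv hκ ha hb (Lp.aestronglyMeasurable f) hvq hv0 ?_ ?_ ?_ ?_
        hα1 hαinv hαn hvb hfk
      · simp [hqdef]
      · rw [hqdef, ENNReal.inv_ne_top]
        exact (tsub_pos_of_lt hr1).ne'
      · rw [hqdef, inv_inv, add_tsub_cancel_of_le hr1.le]
      · rw [hqdef, inv_inv]
        exact ENNReal.le_sub_of_add_le_left hri hrs1.le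
  -- conclusion
  have hB : 0 ≤ greenBound n (-ev.re) 4 α := by
    have := Real.Gamma_pos_of_pos (s := 1 - n / 2 * (1 - 1 / α)) (by linarith)
    rw [greenBound_four hκ hα0]
    positivity
  have main' := ENNReal.toReal_mono (ENNReal.mul_ne_top hb.2.ne
    (ENNReal.mul_ne_top ENNReal.ofReal_ne_top ha.2.ne)) main
  rw [ENNReal.toReal_one, ENNReal.toReal_mul, ENNReal.toReal_mul, ENNReal.toReal_ofReal hB,
    greenBound_four hκ hα0, div_mul_eq_mul_div, mul_div_assoc', le_div_iff₀ (by positivity),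
    one_mul] at main'
  rw [abs_of_neg hre]
  refine main'.trans (le_of_eq ?_)
  ring
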